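/- For $x\in\mathbb{R}^2$ write $\langle x\rangle=\sqrt{1+|x|^2}$. Let $\lambda\in\mathbb{C}$ and let $N,P\ge 0$ be such that $\beta_c=\beta_0=1$, where $\beta_c=\max\{2-2P,\tfrac{4-2N}{3}\}$ and $\beta_0=\max\{\beta_c,1\}$. (a) If $\tfrac{4-2N}{3}=1$, then there exist a bounded measurable function $V:\mathbb{R}^2\to\mathbb{C}$ and a nonzero $C^2$ function $u:\mathbb{R}^2\to\mathbb{C}$ with $$\Delta u+\lambda u=Vu\quad\text{in }\mathbb{R}^2,$$ and a constant $C>0$ such that $|V(x)|\le C\log|x|\,\langle x\rangle^{-1/2}$ for all $|x|\ge 2$. (b) If $2-2P=1$, then there exist a measurable $W:\mathbb{R}^2\to\mathbb{C}^2$ and a nonzero $C^2$ function $u:\mathbb{R}^2\to\mathbb{C}$ with $$\Delta u+\lambda u=W\cdot\nabla u\quad\text{in }\mathbb{R}^2,\qquad W\cdot\nabla u=W_1\partial_1u+W_2\partial_2u,$$ and a constant $C>0$ such that $|W(x)|\le C\langle x\rangle^{-1/2}$ for all $x\in\mathbb{R}^2$. (c) If $\tfrac{4-2N}{3}=1$ and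 $\lambda$ is real with $\lambda>0$, then there exist a measurable $V:\mathbb{R}^2\to\mathbb{C}$ and a nonzero $C^2$ function $u:\mathbb{R}^2\to\mathbb{C}$ with $\Delta u+\lambda u=Vu$ in $\mathbb{R}^2$, and a constant $C>0$ such that $|V(x)|\le C\langle x\rangle^{-1/2}$ for all $x\in\mathbb{R}^2$. In each case $u$ can be chosen so that, in addition, there are constants $C,c>0$ with $|u(x)|\le C\exp(-c|x|)$ for all $x\in\mathbb{R}^2$. -/

import Mathlib

open scoped Laplacian

noncomputable section

namespace BorderlineDecay

/-- The Euclidean plane. -/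
abbrev Plane : Type := EuclideanSpace ℝ (Fin 2)

/-- The bracket `⟨x⟩ = √(1 + |x|²)`. -/
def bracket (x : Plane) : ℝ := Real.sqrt (1 + ‖x‖ ^ 2)

/-- The critical exponent `β_c = max {2 - 2P, (4 - 2N)/3}`. -/
def betaC (N P : ℝ) : ℝ := max (2 - 2 * P) ((4 - 2 * N) / 3)

/-- The exponent `β_0 = max {β_c, 1}`. -/
def betaZero (N P : ℝ) : ℝ := max (betaC N P) 1

/-- The (bilinear) product `W · ∇u = W₁ ∂₁u + W₂ ∂₂u` at the point `x`, for a complex vector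
field `W` and a complex-valued function `u`. -/
def driftTerm (W : Plane → EuclideanSpace ℂ (Fin 2)) (u : Plane → ℂ) (x : Plane) : ℂ :=
  ∑ i : Fin 2, W x i * fderiv ℝ u x (EuclideanSpace.single i (1 : ℝ))

/-- `u` is an eigenfunction for `Δu + λu = Vu` on the plane: a nonzero `C²` function which
satisfies the equation at every point. -/
def IsPotentialEigenfunction (l : ℂ) (V : Plane → ℂ) (u : Plane → ℂ) : Prop :=
  ContDiff ℝ 2 u ∧ u ≠ 0 ∧ ∀ x, (Δ u) x + l * u x = V x * u x

/-- `u` is an eigenfunction for `Δu + λu = W · ∇u` on the plane: a nonzero `C²` function which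
satisfies the equation at every point. -/
def IsDriftEigenfunction (l : ℂ) (W : Plane → EuclideanSpace ℂ (Fin 2)) (u : Plane → ℂ) : Prop :=
  ContDiff ℝ 2 u ∧ u ≠ 0 ∧ ∀ x, (Δ u) x + l * u x = driftTerm W u x

/-- `|u(x)| ≤ C exp(-c|x|)` on the plane, for some constants `C, c > 0`. -/
def DecaysExponentially (u : Plane → ℂ) : Prop :=
  ∃ C c : ℝ, 0 < C ∧ 0 < c ∧ ∀ x, ‖u x‖ ≤ C * Real.exp (-c * ‖x‖)

end BorderlineDecay

end

/-! All three parts follow from `hasDecayingSolution`: for every `l` some nonzero, exponentially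
decaying `C²` function `u` satisfies `|Δu + lu| ≤ C⟨x⟩^{-1/2}|u|` and `|u| ≤ C|∇u|`. The quotients
`V = (Δu + lu)/u` and `W = (Δu + lu) conj(∇u)/|∇u|²` then do the job: by the two inequalities, the
numerators vanish wherever the denominators do. The logarithm in (a) only weakens the bound so
obtained.

If `l` is not in `[0, ∞)`, then `-l = A²` with `Re A > 0`, and `r^{1/2} e^{-Ar} e^{iθ}` solves the
equation up to a relative error `O(1/r)`; near the origin it is replaced by `z`
(`hasDecayingSolution_of_sq`).

If `l ≥ 0`, the decay has to be paid for by rotation, as in Meshkov's construction. Take a large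
integer `N` and `A² = N² - l`. For `r^{1/2} e^{-Ar} e^{inθ}` the leading relative error is `A² + l -
n²/r² = N² - n²/r²`, which is `O(r^{-1/2})` as long as `n - Nr = O(√r)`. So the frequency must grow
with `r`. With `t = √r`, it is `Nj²` at the start of the annulus `j ≤ t ≤ j + 1` and `N(j + 1)²` at
its end.

The change of frequency is made by superposing `e^{inθ}` and a wave of opposite rotation, with `n =
Nj²` and `n' = N(j + 1)²`. The sum has zeros, and `Δu + lu` must vanish there too. Put `τ = (n +
n')θ`. Modulating the second phase to `-(n'θ + ε sin τ)` leaves the possible zeros at `τ ≡ π`, but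
changes the local frequency there to `m = n' - ε(n + n')`. The ratio of the two waves is taken to
grow like `exp(-c/t²)` with `c = (n² - m²)/(2A)`. Then the operator multiplies both waves by the
same factor at `τ ≡ π` (`waveCoeff_sub_waveCoeff`), the mismatch elsewhere is `O(|cos(τ/2)|/t)`, and
`|cos(τ/2)|` is bounded by the sum of the waves (`abs_cos_le_norm_exp_add_exp`). The amplitude `ε`
makes `m` smaller than `n`, although `n' > n`: hence the second wave overtakes the first as `t`
grows. Away from the middle third one wave is at least twice the other, and cutting off the smaller
one is harmless.

The gradient controls `u` because the radial derivative sees the sum of the waves and the angular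
one their difference (`le_six_mul_of_wave_bounds`). The estimates are uniform in `j`
(`block_estimates`), and consecutive blocks coincide near their common circle, so they glue to a
`C²` function (`gluedWave`). -/

namespace BorderlineDecay

open Filter Topology

/-! ### Polar frames and the Laplacian in the variables `(√r, θ)` -/

/-- The point of the plane with polar coordinates `(r, θ)`. -/
noncomputable def polar (r θ : ℝ) : Plane := !₂[r * Real.cos θ, r * Real.sin θ]

/-- The radial unit vector at the angle `θ`. -/
noncomputable def radialVec (θ : ℝ) : Plane := !₂[Real.cos θ, Real.sin θ]

/-- The tangential unit vector at the angle `θ`. -/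
noncomputable def tangentVec (θ : ℝ) : Plane := !₂[-Real.sin θ, Real.cos θ]

lemma norm_radialVec (θ : ℝ) : ‖radialVec θ‖ = 1 := by
  simp [radialVec, EuclideanSpace.norm_eq]

lemma norm_tangentVec (θ : ℝ) : ‖tangentVec θ‖ = 1 := by
  simp [tangentVec, EuclideanSpace.norm_eq]

lemma polar_eq_smul (r θ : ℝ) : polar r θ = r • radialVec θ := by
  ext i; fin_cases i <;> simp [polar, radialVec]

lemma norm_polar {r : ℝ} (hr : 0 ≤ r) (θ : ℝ) : ‖polar r θ‖ = r := by
  rw [polar_eq_smul, norm_smul, norm_radialVec, mul_one, Real.norm_of_nonneg hr]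

lemma exists_polar (x : Plane) : ∃ θ : ℝ, x = polar ‖x‖ θ := by
  set z : ℂ := ⟨x 0, x 1⟩ with hz
  have hn : ‖z‖ = ‖x‖ := by
    rw [Complex.norm_def, Complex.normSq_apply, EuclideanSpace.norm_eq]
    simp [hz, Fin.sum_univ_two, sq]
  refine ⟨z.arg, ?_⟩
  ext i
  fin_cases i
  · simp [polar, ← hn, Complex.norm_mul_cos_arg, hz]
  · simp [polar, ← hn, Complex.norm_mul_sin_arg, hz]

lemma radialVec_eq (θ : ℝ) : radialVec θ = Real.cos θ • EuclideanSpace.single (0 : Fin 2) (1 : ℝ) +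
    Real.sin θ • EuclideanSpace.single (1 : Fin 2) (1 : ℝ) := by
  ext i; fin_cases i <;> simp [radialVec]

lemma tangentVec_eq (θ : ℝ) :
    tangentVec θ = (-Real.sin θ) • EuclideanSpace.single (0 : Fin 2) (1 : ℝ) +
      Real.cos θ • EuclideanSpace.single (1 : Fin 2) (1 : ℝ) := by
  ext i; fin_cases i <;> simp [tangentVec]

lemma hasDerivAt_radialVec (θ : ℝ) : HasDerivAt radialVec (tangentVec θ) θ := by
  rw [funext radialVec_eq, tangentVec_eq]
  exact ((Real.hasDerivAt_cos θ).smul_const _).add ((Real.hasDerivAt_sin θ).smul_const _)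

lemma hasDerivAt_tangentVec (θ : ℝ) : HasDerivAt tangentVec (-radialVec θ) θ := by
  rw [funext tangentVec_eq, radialVec_eq, neg_add, ← neg_smul, ← neg_smul]
  exact ((Real.hasDerivAt_sin θ).neg.smul_const _).add ((Real.hasDerivAt_cos θ).smul_const _)

/-- The trace of the Hessian does not depend on the orthonormal basis, so each point may use its own
polar frame; the mixed terms cancel. -/
lemma laplacian_eq_fderiv_fderiv (u : Plane → ℂ) (x : Plane) (θ : ℝ) :
    (Δ u) x = fderiv ℝ (fderiv ℝ u) x (radialVec θ) (radialVec θ) +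
      fderiv ℝ (fderiv ℝ u) x (tangentVec θ) (tangentVec θ) := by
  rw [InnerProductSpace.laplacian_eq_iteratedFDeriv_orthonormalBasis u
    (EuclideanSpace.basisFun (Fin 2) ℝ), radialVec_eq, tangentVec_eq]
  simp only [iteratedFDeriv_two_apply, Fin.sum_univ_two, EuclideanSpace.basisFun_apply, map_add,
    map_smul, add_apply, smul_apply,
    Matrix.cons_val_zero, Matrix.cons_val_one, Complex.real_smul]
  have h : (Real.cos θ : ℂ) ^ 2 = 1 - (Real.sin θ : ℂ) ^ 2 := by
    rw [eq_sub_iff_add_eq]; exact_mod_cast Real.cos_sq_add_sin_sq θ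
  push_cast at h ⊢
  linear_combination (-fderiv ℝ (fderiv ℝ u) x (EuclideanSpace.single 0 1)
    (EuclideanSpace.single 0 1) - fderiv ℝ (fderiv ℝ u) x (EuclideanSpace.single 1 1)
    (EuclideanSpace.single 1 1)) * h

/-- First and second derivative of a `C²` function along a curve. -/
lemma deriv_along_curve {u : Plane → ℂ} {γ γ' : ℝ → Plane} {γ'' : Plane} {s : ℝ}
    {p p' : ℝ → ℂ} {p'' : ℂ} (hu : ContDiffAt ℝ 2 u (γ s))
    (hγ : ∀ᶠ a in 𝓝 s, HasDerivAt γ (γ' a) a) (hγ' : HasDerivAt γ' γ'' s)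
    (hp : ∀ᶠ a in 𝓝 s, HasDerivAt p (p' a) a) (hp' : HasDerivAt p' p'' s)
    (hup : ∀ᶠ a in 𝓝 s, u (γ a) = p a) :
    p' s = fderiv ℝ u (γ s) (γ' s) ∧
      p'' = fderiv ℝ (fderiv ℝ u) (γ s) (γ' s) (γ' s) + fderiv ℝ u (γ s) γ'' := by
  have hd : ∀ᶠ y in 𝓝 (γ s), DifferentiableAt ℝ u y :=
    (hu.eventually (by simp)).mono fun y hy => hy.differentiableAt (by simp)
  have hcont : ContinuousAt γ s := hγ.self_of_nhds.continuousAt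
  have key : ∀ᶠ a in 𝓝 s, p' a = fderiv ℝ u (γ a) (γ' a) := by
    filter_upwards [hγ, hp, hup.eventually_nhds, hcont.eventually hd] with a h1 h2 h3 h4
    have h5 := h4.hasFDerivAt.comp_hasDerivAt a h1
    exact h2.unique (h5.congr_of_eventuallyEq (h3.mono fun b hb => by simp [hb]))
  refine ⟨key.self_of_nhds, ?_⟩
  have h2 : DifferentiableAt ℝ (fderiv ℝ u) (γ s) :=
    (hu.fderiv_right (m := 1) (by norm_num)).differentiableAt (by simp)
  have h3 : HasDerivAt (fun a => fderiv ℝ u (γ a)) (fderiv ℝ (fderiv ℝ u) (γ s) (γ' s)) s :=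
    h2.hasFDerivAt.comp_hasDerivAt s hγ.self_of_nhds
  have h4 := h3.clm_apply hγ'
  exact hp'.unique (h4.congr_of_eventuallyEq key)

/-- The Laplacian and the size of the gradient in the polar coordinates `(t ^ 2, θ)`. -/
lemma laplacian_polar {u : Plane → ℂ} {t θ : ℝ} (ht : 0 < t) {p p' q q' : ℝ → ℂ} {p'' q'' : ℂ}
    (hu : ContDiffAt ℝ 2 u (polar (t ^ 2) θ))
    (hp : ∀ᶠ a in 𝓝 t, HasDerivAt p (p' a) a) (hp' : HasDerivAt p' p'' t)
    (hup : ∀ᶠ a in 𝓝 t, u (polar (a ^ 2) θ) = p a)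
    (hq : ∀ᶠ a in 𝓝 θ, HasDerivAt q (q' a) a) (hq' : HasDerivAt q' q'' θ)
    (huq : ∀ᶠ a in 𝓝 θ, u (polar (t ^ 2) a) = q a) :
    (Δ u) (polar (t ^ 2) θ) = (p'' + p' t / t) / (4 * t ^ 2) + q'' / t ^ 4 ∧
      ‖p' t‖ ≤ 2 * t * ‖fderiv ℝ u (polar (t ^ 2) θ)‖ ∧
      ‖q' θ‖ ≤ t ^ 2 * ‖fderiv ℝ u (polar (t ^ 2) θ)‖ := by
  have g1 : ∀ a : ℝ, HasDerivAt (fun a : ℝ => polar (a ^ 2) θ) ((2 * a) • radialVec θ) a := by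
    intro a
    simp_rw [polar_eq_smul]
    simpa using (hasDerivAt_pow 2 a).smul_const (radialVec θ)
  have g2 : HasDerivAt (fun a : ℝ => (2 * a) • radialVec θ) ((2 : ℝ) • radialVec θ) t := by
    simpa using ((hasDerivAt_id t).const_mul (2 : ℝ)).smul_const (radialVec θ)
  have g3 : ∀ a : ℝ, HasDerivAt (fun a : ℝ => polar (t ^ 2) a) ((t ^ 2) • tangentVec a) a := by
    intro a
    simp_rw [polar_eq_smul]
    exact (hasDerivAt_radialVec a).const_smul (t ^ 2)
  have g4 : HasDerivAt (fun a : ℝ => (t ^ 2) • tangentVec a) ((t ^ 2) • (-radialVec θ)) θ :=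
    (hasDerivAt_tangentVec θ).const_smul (t ^ 2)
  obtain ⟨a1, a2⟩ := deriv_along_curve (γ := fun a : ℝ => polar (a ^ 2) θ) hu
    (Eventually.of_forall g1) g2 hp hp' hup
  obtain ⟨b1, b2⟩ := deriv_along_curve (γ := fun a : ℝ => polar (t ^ 2) a) hu
    (Eventually.of_forall g3) g4 hq hq' huq
  refine ⟨?_, ?_, ?_⟩
  -- The acceleration of the circle points inwards and contributes the first-order radial term.
  -- Together with the change of variable `r = t²`, it produces `p'/t`.
  · rw [laplacian_eq_fderiv_fderiv u _ θ, a2, b2, a1]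
    simp only [map_smul, map_neg, smul_apply, Complex.real_smul]
    have : (t : ℂ) ≠ 0 := by exact_mod_cast ht.ne'
    push_cast
    field_simp
    ring
  · rw [a1]
    refine (ContinuousLinearMap.le_opNorm _ _).trans (le_of_eq ?_)
    rw [norm_smul, norm_radialVec, Real.norm_of_nonneg (by positivity)]; ring
  · rw [b1]
    refine (ContinuousLinearMap.le_opNorm _ _).trans (le_of_eq ?_)
    rw [norm_smul, norm_tangentVec, Real.norm_of_nonneg (by positivity)]; ring

/-! ### Sums of two waves and the conjugated operator -/

/-- On the half-line `(0, ∞)`, the function `f` has the derivatives `f'` and `f''`. -/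
def HasTwoDerivs (f f' f'' : ℝ → ℝ) : Prop :=
  ∀ a, 0 < a → HasDerivAt f (f' a) a ∧ HasDerivAt f' (f'' a) a

/-- The unit complex number `(x₀ + σ i x₁) / |x|`. -/
noncomputable def unitPhase (σ : ℝ) (x : Plane) : ℂ :=
  ((x 0 : ℂ) + σ * x 1 * Complex.I) / ‖x‖

/-- The radial weight `t exp(-A t²)`. -/
noncomputable def weight (A : ℂ) (t : ℝ) : ℂ := t * Complex.exp (-A * t ^ 2)

/-- The sum of the two waves `α₁ e^{κ₁ + i n θ}` and `α₂ e^{κ₂ - i (n' θ + β sin ((n + n') θ))}`,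
where the coefficients are functions of `√|x|`, times the weight `|x|^{1/2} exp(-A |x|)`. -/
noncomputable def twoWave (A : ℂ) (σ : ℝ) (n n' : ℕ) (α₁ κ₁ α₂ κ₂ β : ℝ → ℝ) (x : Plane) : ℂ :=
  weight A √‖x‖ * (α₁ √‖x‖ * (Complex.exp (κ₁ √‖x‖) * unitPhase σ x ^ n) +
    α₂ √‖x‖ * (Complex.exp (κ₂ √‖x‖ - Complex.I * (β √‖x‖ * (unitPhase σ x ^ (n + n')).im)) *
      (starRingEnd ℂ (unitPhase σ x)) ^ n'))

lemma unitPhase_polar {σ : ℝ} (hσ : σ = 1 ∨ σ = -1) {r : ℝ} (hr : 0 < r) (θ : ℝ) :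
    unitPhase σ (polar r θ) = Complex.exp (Complex.I * (σ * θ)) := by
  have hr' : (r : ℂ) ≠ 0 := by exact_mod_cast hr.ne'
  have h : Complex.exp (Complex.I * (σ * θ)) = Real.cos θ + σ * Real.sin θ * Complex.I := by
    rcases hσ with rfl | rfl
    · rw [mul_comm]; simp [Complex.exp_mul_I]
    · rw [mul_comm, show (((-1 : ℝ) : ℂ) * θ) = ((-θ : ℝ) : ℂ) by push_cast; ring,
        Complex.exp_mul_I]
      simp
  rw [unitPhase, norm_polar hr.le, h]
  simp only [polar, PiLp.toLp_apply, Matrix.cons_val_zero, Matrix.cons_val_one]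
  push_cast
  field_simp

/-- The phase of the second wave. -/
noncomputable def secondPhase (n n' : ℕ) (b θ : ℝ) : ℂ :=
  -Complex.I * (n' * θ + b * Real.sin ((n + n' : ℕ) * θ))

lemma twoWave_polar (A : ℂ) {σ : ℝ} (hσ : σ = 1 ∨ σ = -1) (n n' : ℕ) (α₁ κ₁ α₂ κ₂ β : ℝ → ℝ)
    {t : ℝ} (ht : 0 < t) (θ : ℝ) :
    twoWave A σ n n' α₁ κ₁ α₂ κ₂ β (polar (t ^ 2) θ) = weight A t *
      (α₁ t * Complex.exp (κ₁ t + Complex.I * (n * (σ * θ : ℝ))) +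
        α₂ t * Complex.exp (κ₂ t + secondPhase n n' (β t) (σ * θ))) := by
  have h1 : √‖polar (t ^ 2) θ‖ = t := by
    rw [norm_polar (sq_nonneg t), Real.sqrt_sq ht.le]
  have h2 : ∀ k : ℕ, Complex.exp (Complex.I * (σ * θ)) ^ k =
      Complex.exp (Complex.I * (k * (σ * θ : ℝ))) := by
    intro k; rw [← Complex.exp_nat_mul]; congr 1; push_cast; ring
  have h3 : starRingEnd ℂ (Complex.exp (Complex.I * (σ * θ))) =
      Complex.exp (-Complex.I * (σ * θ)) := by
    rw [← Complex.exp_conj]; simp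
  have h4 : ∀ k : ℕ, (Complex.exp (Complex.I * (k * (σ * θ : ℝ)))).im =
      Real.sin (k * (σ * θ)) := by
    intro k
    rw [mul_comm, show ((k : ℂ) * ((σ * θ : ℝ) : ℂ)) = ((k * (σ * θ) : ℝ) : ℂ) by push_cast; ring,
      Complex.exp_ofReal_mul_I_im]
  have h5 : (κ₂ t + secondPhase n n' (β t) (σ * θ) : ℂ) =
      κ₂ t - Complex.I * (β t * Real.sin ((n + n' : ℕ) * (σ * θ))) +
        n' * (-Complex.I * (σ * θ)) := by
    simp only [secondPhase]
    push_cast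
    ring
  rw [twoWave, h1, unitPhase_polar hσ (by positivity), h3, h2, h2, h4, ← Complex.exp_nat_mul, h5,
    Complex.exp_add, Complex.exp_add]

lemma contDiffAt_unitPhase (σ : ℝ) {x : Plane} (hx : x ≠ 0) : ContDiffAt ℝ 2 (unitPhase σ) x := by
  have hn : ContDiffAt ℝ 2 (fun x : Plane => (‖x‖ : ℂ)) x :=
    Complex.ofRealCLM.contDiff.contDiffAt.comp x (contDiffAt_norm ℝ hx)
  have hc : ∀ i : Fin 2, ContDiffAt ℝ 2 (fun x : Plane => (x i : ℂ)) x := fun i =>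
    Complex.ofRealCLM.contDiff.contDiffAt.comp x
      (EuclideanSpace.proj i : Plane →L[ℝ] ℝ).contDiff.contDiffAt
  unfold unitPhase
  have hx' : (‖x‖ : ℂ) ≠ 0 := by exact_mod_cast norm_ne_zero_iff.2 hx
  simp_rw [div_eq_mul_inv]
  exact ((hc 0).add ((contDiffAt_const.mul (hc 1)).mul contDiffAt_const)).mul (hn.inv hx')

lemma contDiffAt_sqrt_norm {x : Plane} (hx : x ≠ 0) :
    ContDiffAt ℝ 2 (fun x : Plane => √‖x‖) x :=
  (contDiffAt_norm ℝ hx).sqrt (norm_ne_zero_iff.2 hx)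

/-- The phases enter only through powers of `x/|x|` and their imaginary parts, never through an
angle, so no branch cut arises off the origin. -/
lemma contDiffAt_twoWave (A : ℂ) (σ : ℝ) (n n' : ℕ) {α₁ κ₁ α₂ κ₂ β : ℝ → ℝ}
    (h1 : ContDiffOn ℝ 2 α₁ (Set.Ioi 0)) (h2 : ContDiffOn ℝ 2 κ₁ (Set.Ioi 0))
    (h3 : ContDiffOn ℝ 2 α₂ (Set.Ioi 0)) (h4 : ContDiffOn ℝ 2 κ₂ (Set.Ioi 0))
    (h5 : ContDiffOn ℝ 2 β (Set.Ioi 0)) {x : Plane} (hx : x ≠ 0) :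
    ContDiffAt ℝ 2 (twoWave A σ n n' α₁ κ₁ α₂ κ₂ β) x := by
  have ht : 0 < √‖x‖ := Real.sqrt_pos.2 (norm_pos_iff.2 hx)
  have key : ∀ {f : ℝ → ℝ}, ContDiffOn ℝ 2 f (Set.Ioi 0) →
      ContDiffAt ℝ 2 (fun x : Plane => ((f √‖x‖ : ℝ) : ℂ)) x := by
    intro f hf
    exact Complex.ofRealCLM.contDiff.contDiffAt.comp x
      ((hf.contDiffAt (Ioi_mem_nhds ht)).comp x (contDiffAt_sqrt_norm hx))
  have ht' : ContDiffAt ℝ 2 (fun x : Plane => ((√‖x‖ : ℝ) : ℂ)) x := key contDiffOn_id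
  have hω := contDiffAt_unitPhase σ hx
  have hc : ContDiffAt ℝ 2 (fun x => starRingEnd ℂ (unitPhase σ x)) x :=
    Complex.conjCLE.contDiff.contDiffAt.comp x hω
  have him : ContDiffAt ℝ 2 (fun x => (((unitPhase σ x ^ (n + n')).im : ℝ) : ℂ)) x :=
    Complex.ofRealCLM.contDiff.contDiffAt.comp x
      (Complex.imCLM.contDiff.contDiffAt.comp x (hω.pow _))
  have hw : ContDiffAt ℝ 2 (fun x : Plane => weight A √‖x‖) x := by
    unfold weight
    exact ht'.mul (contDiffAt_const.mul (ht'.pow 2)).cexp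
  unfold twoWave
  exact hw.mul (((key h1).mul ((key h2).cexp.mul (hω.pow n))).add
    ((key h3).mul (((key h4).sub (contDiffAt_const.mul ((key h5).mul him))).cexp.mul (hc.pow n'))))

/-- The coefficient which a wave `α e^Ψ` receives from the conjugated operator. -/
noncomputable def waveCoeff (A : ℂ) (t : ℝ) (α α' α'' p p' b : ℂ) : ℂ :=
  α * b - A / t * (α' + α * p) +
    (α'' + 2 * α' * p + α * (p' + p ^ 2) + 3 * (α' + α * p) / t + (1 / t ^ 2 - 8 * A) * α) /
      (4 * t ^ 2)

lemma hasDerivAt_wave {α α' Ψ Ψ' : ℝ → ℂ} {t : ℝ}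
    (h1 : HasDerivAt α (α' t) t) (h2 : HasDerivAt Ψ (Ψ' t) t) :
    HasDerivAt (fun a => α a * Complex.exp (Ψ a))
      ((α' t + α t * Ψ' t) * Complex.exp (Ψ t)) t := by
  exact (h1.mul h2.cexp).congr_deriv (by ring)

lemma hasDerivAt_wave_deriv {α α' Ψ Ψ' : ℝ → ℂ} {α'' Ψ'' : ℂ} {t : ℝ}
    (h1 : HasDerivAt α (α' t) t) (h2 : HasDerivAt Ψ (Ψ' t) t)
    (h3 : HasDerivAt α' α'' t) (h4 : HasDerivAt Ψ' Ψ'' t) :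
    HasDerivAt (fun a => (α' a + α a * Ψ' a) * Complex.exp (Ψ a))
      ((α'' + 2 * α' t * Ψ' t + α t * (Ψ'' + Ψ' t ^ 2)) * Complex.exp (Ψ t)) t := by
  exact (hasDerivAt_wave (α := fun a => α' a + α a * Ψ' a)
    (α' := fun _ => α'' + (α' t * Ψ' t + α t * Ψ'')) (h3.add (h1.mul h4)) h2).congr_deriv (by ring)

lemma hasDerivAt_weight (A : ℂ) (t : ℝ) :
    HasDerivAt (weight A) ((1 - 2 * A * t ^ 2) * Complex.exp (-A * t ^ 2)) t := by
  have h : HasDerivAt (fun a : ℝ => (a : ℂ)) 1 t := (hasDerivAt_id t).ofReal_comp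
  have h2 : HasDerivAt (fun a : ℝ => -A * (a : ℂ) ^ 2) (-A * (2 * t)) t :=
    ((h.pow 2).const_mul (-A)).congr_deriv (by simp)
  exact (hasDerivAt_wave (α' := fun _ => 1) (Ψ' := fun a => -A * (2 * a)) h h2).congr_deriv
    (by ring)

lemma hasDerivAt_weight_mul {A : ℂ} {R R' : ℝ → ℂ} {t : ℝ} (ht : 0 < t)
    (h : HasDerivAt R (R' t) t) :
    HasDerivAt (fun a => weight A a * R a)
      (weight A t * (R' t + (1 / t - 2 * A * t) * R t)) t := by
  refine ((hasDerivAt_weight A t).mul h).congr_deriv ?_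
  have : (t : ℂ) ≠ 0 := by exact_mod_cast ht.ne'
  unfold weight
  field_simp
  ring

lemma hasDerivAt_weight_mul_deriv {A : ℂ} {R R' : ℝ → ℂ} {R'' : ℂ} {t : ℝ} (ht : 0 < t)
    (h : HasDerivAt R (R' t) t) (h' : HasDerivAt R' R'' t) :
    HasDerivAt (fun a : ℝ => weight A a * (R' a + (1 / a - 2 * A * a) * R a))
      (weight A t * (R'' + 2 * (1 / t - 2 * A * t) * R' t +
        (4 * A ^ 2 * t ^ 2 - 6 * A) * R t)) t := by
  have h0 : (t : ℂ) ≠ 0 := by exact_mod_cast ht.ne'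
  have hid : HasDerivAt (fun a : ℝ => (a : ℂ)) 1 t := (hasDerivAt_id t).ofReal_comp
  have h2 : HasDerivAt (fun a : ℝ => (1 / (a : ℂ) - 2 * A * a)) (-1 / t ^ 2 - 2 * A) t := by
    simp_rw [one_div]
    exact ((hid.inv h0).sub (hid.const_mul (2 * A))).congr_deriv (by simp)
  refine (hasDerivAt_weight_mul (A := A) (R := fun a : ℝ => R' a + (1 / a - 2 * A * a) * R a)
    (R' := fun _ => R'' + ((-1 / t ^ 2 - 2 * A) * R t + (1 / t - 2 * A * t) * R' t)) ht
    (h'.add (h2.mul h))).congr_deriv ?_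
  field_simp
  ring

/-- The equation and the gradient for a sum of two waves. -/
lemma twoWave_formulas {A l : ℂ} {σ : ℝ} (hσ : σ = 1 ∨ σ = -1) {n n' : ℕ}
    {α₁ α₁' α₁'' κ₁ κ₁' κ₁'' α₂ α₂' α₂'' κ₂ κ₂' κ₂'' β β' β'' : ℝ → ℝ}
    (h1 : HasTwoDerivs α₁ α₁' α₁'') (h2 : HasTwoDerivs κ₁ κ₁' κ₁'')
    (h3 : HasTwoDerivs α₂ α₂' α₂'') (h4 : HasTwoDerivs κ₂ κ₂' κ₂'')
    (h5 : HasTwoDerivs β β' β'') {t θ ϑ : ℝ} (ht : 0 < t) (hϑ : ϑ = σ * θ)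
    (hu : ContDiffAt ℝ 2 (twoWave A σ n n' α₁ κ₁ α₂ κ₂ β) (polar (t ^ 2) θ))
    {Ψ₁ Ψ₂ p₁ p₂ p₁' p₂' f₁ f₂ f₂' : ℂ}
    (hΨ₁ : Ψ₁ = κ₁ t + Complex.I * (n * ϑ)) (hΨ₂ : Ψ₂ = κ₂ t + secondPhase n n' (β t) ϑ)
    (hp₁ : p₁ = κ₁' t) (hp₂ : p₂ = κ₂' t - Complex.I * (β' t * Real.sin ((n + n' : ℕ) * ϑ)))
    (hp₁' : p₁' = κ₁'' t)
    (hp₂' : p₂' = κ₂'' t - Complex.I * (β'' t * Real.sin ((n + n' : ℕ) * ϑ)))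
    (hf₁ : f₁ = Complex.I * n)
    (hf₂ : f₂ = -Complex.I * (n' + β t * ((n + n' : ℕ) * Real.cos ((n + n' : ℕ) * ϑ))))
    (hf₂' : f₂' = Complex.I * (β t * ((n + n' : ℕ) ^ 2 * Real.sin ((n + n' : ℕ) * ϑ)))) :
    (Δ (twoWave A σ n n' α₁ κ₁ α₂ κ₂ β)) (polar (t ^ 2) θ) +
        l * twoWave A σ n n' α₁ κ₁ α₂ κ₂ β (polar (t ^ 2) θ) = weight A t *
      (Complex.exp Ψ₁ * waveCoeff A t (α₁ t) (α₁' t) (α₁'' t) p₁ p₁'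
          (A ^ 2 + l + f₁ ^ 2 / t ^ 4) +
        Complex.exp Ψ₂ * waveCoeff A t (α₂ t) (α₂' t) (α₂'' t) p₂ p₂'
          (A ^ 2 + l + (f₂' + f₂ ^ 2) / t ^ 4)) ∧
    ‖weight A t * ((α₁' t + α₁ t * p₁) * Complex.exp Ψ₁ + (α₂' t + α₂ t * p₂) * Complex.exp Ψ₂ +
        (1 / t - 2 * A * t) * (α₁ t * Complex.exp Ψ₁ + α₂ t * Complex.exp Ψ₂))‖ ≤
      2 * t * ‖fderiv ℝ (twoWave A σ n n' α₁ κ₁ α₂ κ₂ β) (polar (t ^ 2) θ)‖ ∧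
    ‖weight A t * (α₁ t * f₁ * Complex.exp Ψ₁ + α₂ t * f₂ * Complex.exp Ψ₂)‖ ≤
      t ^ 2 * ‖fderiv ℝ (twoWave A σ n n' α₁ κ₁ α₂ κ₂ β) (polar (t ^ 2) θ)‖ := by
  have ht0 : (t : ℂ) ≠ 0 := by exact_mod_cast ht.ne'
  have hσ2 : (σ : ℂ) ^ 2 = 1 := by rcases hσ with rfl | rfl <;> norm_num
  have hσn : ‖(σ : ℂ)‖ = 1 := by rcases hσ with rfl | rfl <;> simp
  set M : ℂ := ((n + n' : ℕ) : ℂ) with hM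
  set S : ℂ := (Real.sin ((n + n' : ℕ) * ϑ) : ℂ) with hS
  have ev : ∀ᶠ a in 𝓝 t, 0 < a := lt_mem_nhds ht
  -- the radial derivatives
  let R : ℝ → ℂ := fun a => α₁ a * Complex.exp (κ₁ a + Complex.I * (n * ϑ)) +
    α₂ a * Complex.exp (κ₂ a - Complex.I * (n' * ϑ + β a * S))
  let R' : ℝ → ℂ := fun a =>
    (α₁' a + α₁ a * κ₁' a) * Complex.exp (κ₁ a + Complex.I * (n * ϑ)) +
    (α₂' a + α₂ a * (κ₂' a - Complex.I * (β' a * S))) *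
      Complex.exp (κ₂ a - Complex.I * (n' * ϑ + β a * S))
  have dΨ₁ : ∀ a, 0 < a →
      HasDerivAt (fun a => (κ₁ a + Complex.I * (n * ϑ) : ℂ)) (κ₁' a) a := fun a ha =>
    (h2 a ha).1.ofReal_comp.add_const _
  have dΨ₂ : ∀ a, 0 < a →
      HasDerivAt (fun a => (κ₂ a - Complex.I * (n' * ϑ + β a * S) : ℂ))
        (κ₂' a - Complex.I * (β' a * S)) a := fun a ha =>
    (h4 a ha).1.ofReal_comp.sub
      ((((h5 a ha).1.ofReal_comp.mul_const S).const_add _).const_mul Complex.I)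
  have dΨ₂' : HasDerivAt (fun a => (κ₂' a - Complex.I * (β' a * S) : ℂ))
        (κ₂'' t - Complex.I * (β'' t * S)) t :=
    (h4 t ht).2.ofReal_comp.sub (((h5 t ht).2.ofReal_comp.mul_const S).const_mul Complex.I)
  have dR : ∀ a, 0 < a → HasDerivAt R (R' a) a := fun a ha =>
    (hasDerivAt_wave (α' := fun a => (α₁' a : ℂ)) (Ψ' := fun a => (κ₁' a : ℂ))
      (h1 a ha).1.ofReal_comp (dΨ₁ a ha)).add
    (hasDerivAt_wave (α' := fun a => (α₂' a : ℂ))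
      (Ψ' := fun a => (κ₂' a - Complex.I * (β' a * S) : ℂ))
      (h3 a ha).1.ofReal_comp (dΨ₂ a ha))
  have dR' := (hasDerivAt_wave_deriv (α' := fun a => (α₁' a : ℂ)) (Ψ' := fun a => (κ₁' a : ℂ))
      (h1 t ht).1.ofReal_comp (dΨ₁ t ht) (h1 t ht).2.ofReal_comp (h2 t ht).2.ofReal_comp).add
    (hasDerivAt_wave_deriv (α' := fun a => (α₂' a : ℂ))
      (Ψ' := fun a => (κ₂' a - Complex.I * (β' a * S) : ℂ))
      (h3 t ht).1.ofReal_comp (dΨ₂ t ht) (h3 t ht).2.ofReal_comp dΨ₂')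
  -- the angular derivatives
  let Φ₁ : ℝ → ℂ := fun a => κ₁ t + Complex.I * (n * (σ * a : ℝ))
  let Φ₂ : ℝ → ℂ := fun a => κ₂ t + secondPhase n n' (β t) (σ * a)
  let Φ₂' : ℝ → ℂ := fun a =>
    -Complex.I * (n' + β t * (M * Real.cos ((n + n' : ℕ) * (σ * a)))) * σ
  have dm : ∀ a : ℝ, HasDerivAt (fun a => σ * a) σ a := fun a => by
    simpa using (hasDerivAt_id a).const_mul σ
  have dΦ₁ : ∀ a, HasDerivAt Φ₁ (f₁ * σ) a := fun a => by
    have := (((dm a).ofReal_comp.const_mul (n : ℂ)).const_mul Complex.I).const_add (κ₁ t : ℂ)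
    exact this.congr_deriv (by rw [hf₁]; ring)
  have dsin : ∀ a : ℝ, HasDerivAt (fun a => ((Real.sin ((n + n' : ℕ) * (σ * a)) : ℝ) : ℂ))
      (M * Real.cos ((n + n' : ℕ) * (σ * a)) * σ) a := fun a => by
    have := (((dm a).const_mul ((n + n' : ℕ) : ℝ)).sin).ofReal_comp
    exact this.congr_deriv (by rw [hM]; push_cast; ring)
  have dcos : ∀ a : ℝ, HasDerivAt (fun a => ((Real.cos ((n + n' : ℕ) * (σ * a)) : ℝ) : ℂ))
      (-M * Real.sin ((n + n' : ℕ) * (σ * a)) * σ) a := fun a => by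
    have := (((dm a).const_mul ((n + n' : ℕ) : ℝ)).cos).ofReal_comp
    exact this.congr_deriv (by rw [hM]; push_cast; ring)
  have dΦ₂ : ∀ a, HasDerivAt Φ₂ (Φ₂' a) a := fun a => by
    have := ((((dm a).ofReal_comp.const_mul (n' : ℂ)).add
      ((dsin a).const_mul (β t : ℂ))).const_mul (-Complex.I)).const_add (κ₂ t : ℂ)
    exact this.congr_deriv (by simp only [Φ₂']; ring)
  have dΦ₂' : HasDerivAt Φ₂' (f₂') θ := by
    have := ((((dcos θ).const_mul M).const_mul (β t : ℂ)).const_add (n' : ℂ)).const_mul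
      (-Complex.I) |>.mul_const (σ : ℂ)
    refine this.congr_deriv ?_
    rw [hf₂', hS, hϑ]
    linear_combination (Complex.I * (β t * (M ^ 2 * Real.sin ((n + n' : ℕ) * (σ * θ))))) * hσ2
  have eΦ₂ : Φ₂' θ = f₂ * σ := by simp only [Φ₂', hf₂, hϑ]
  have dQ : ∀ a, HasDerivAt (fun a => weight A t * (α₁ t * Complex.exp (Φ₁ a) +
      α₂ t * Complex.exp (Φ₂ a))) (weight A t * ((0 + α₁ t * (f₁ * σ)) * Complex.exp (Φ₁ a) +
      (0 + α₂ t * Φ₂' a) * Complex.exp (Φ₂ a))) a := fun a =>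
    ((hasDerivAt_wave (α' := fun _ => 0) (Ψ' := fun _ => f₁ * σ) (hasDerivAt_const a _)
      (dΦ₁ a)).add (hasDerivAt_wave (α' := fun _ => 0) (hasDerivAt_const a _)
        (dΦ₂ a))).const_mul _
  have dQ' := ((hasDerivAt_wave_deriv (α' := fun _ => 0) (Ψ' := fun _ => f₁ * σ)
      (hasDerivAt_const θ (α₁ t : ℂ))
      (dΦ₁ θ) (hasDerivAt_const θ (0 : ℂ)) (hasDerivAt_const θ (f₁ * σ))).add
    (hasDerivAt_wave_deriv (α' := fun _ => 0) (hasDerivAt_const θ (α₂ t : ℂ))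
        (dΦ₂ θ) (hasDerivAt_const θ (0 : ℂ)) dΦ₂')).const_mul (weight A t)
  have eΨ₂ : (κ₂ t - Complex.I * (n' * ϑ + β t * S) : ℂ) = Ψ₂ := by
    rw [hΨ₂, secondPhase]; ring
  have eΦ₁ : Φ₁ θ = Ψ₁ := by rw [hΨ₁, hϑ]
  have eΦ₂' : Φ₂ θ = Ψ₂ := by rw [hΨ₂, hϑ]
  obtain ⟨k1, k2, k3⟩ := laplacian_polar ht hu
    (p := fun a => weight A a * R a)
    (p' := fun a => weight A a * (R' a + (1 / a - 2 * A * a) * R a))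
    (ev.mono fun a ha => hasDerivAt_weight_mul ha (dR a ha))
    (hasDerivAt_weight_mul_deriv ht (dR t ht) dR')
    (ev.mono fun a ha => by
      rw [twoWave_polar A hσ n n' _ _ _ _ _ ha, ← hϑ]
      simp only [R, secondPhase, hS]; congr 4; ring)
    (Eventually.of_forall dQ) dQ'
    (Eventually.of_forall fun a => by
      rw [twoWave_polar A hσ n n' _ _ _ _ _ ht])
  simp only [R, R', eΨ₂, eΦ₁, eΦ₂', ← hΨ₁, eΦ₂] at k1 k2 k3
  refine ⟨?_, ?_, ?_⟩
  · rw [k1, twoWave_polar A hσ n n' _ _ _ _ _ ht, ← hϑ, ← hΨ₁, ← hΨ₂, ← hp₂, ← hp₁, ← hp₁',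
      ← hp₂']
    simp only [waveCoeff]
    field_simp
    linear_combination (4 * weight A t * (α₁ t * f₁ ^ 2 * Complex.exp Ψ₁ +
      α₂ t * f₂ ^ 2 * Complex.exp Ψ₂)) * hσ2
  · refine le_of_eq_of_le ?_ k2
    rw [hp₁, hp₂]
  · refine le_of_eq_of_le ?_ k3
    rw [← mul_one ‖_‖, ← hσn, ← norm_mul]
    congr 1; ring

/-! ### From a decaying solution to the potential and the drift -/

/-- A nonzero, exponentially decaying `C²` function for which `Δu + lu` is bounded by
`⟨x⟩^{-1/2} |u|`, and `u` by its gradient. -/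
def HasDecayingSolution (l : ℂ) : Prop :=
  ∃ u : Plane → ℂ, ContDiff ℝ 2 u ∧ u ≠ 0 ∧
    (∃ C : ℝ, 0 < C ∧ ∀ x, ‖(Δ u) x + l * u x‖ ≤ C * bracket x ^ (-(1 / 2) : ℝ) * ‖u x‖) ∧
    (∃ C : ℝ, 0 < C ∧ ∀ x, ‖u x‖ ≤ C * ‖fderiv ℝ u x‖) ∧ DecaysExponentially u

lemma bracket_pos (x : Plane) : 0 < bracket x := Real.sqrt_pos.2 (by positivity)

lemma one_le_bracket (x : Plane) : 1 ≤ bracket x :=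
  Real.one_le_sqrt.2 (by nlinarith [sq_nonneg ‖x‖])

lemma bracket_le_one_add_norm (x : Plane) : bracket x ≤ 1 + ‖x‖ :=
  (Real.sqrt_le_left (by positivity)).2 (by nlinarith [norm_nonneg x])

lemma inv_le_bracket_rpow {x : Plane} {c : ℝ} (hc : 0 < c) (h : bracket x ≤ c ^ 2) :
    1 / c ≤ bracket x ^ (-(1 / 2) : ℝ) := by
  have h1 : (c ^ 2) ^ (-(1 / 2) : ℝ) = 1 / c := by
    rw [Real.rpow_neg (by positivity), ← Real.sqrt_eq_rpow, Real.sqrt_sq hc.le, one_div]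
  rw [← h1]
  exact Real.rpow_le_rpow_of_nonpos (bracket_pos x) h (by norm_num)

lemma continuous_laplacian {u : Plane → ℂ} (hu : ContDiff ℝ 2 u) : Continuous (Δ u) := by
  have h1 : ContDiff ℝ 1 (fderiv ℝ u) := hu.fderiv_right (by norm_num)
  have h2 : Continuous (fderiv ℝ (fderiv ℝ u)) := h1.continuous_fderiv (by simp)
  have h3 : (Δ u) = fun x => fderiv ℝ (fderiv ℝ u) x (radialVec 0) (radialVec 0) +
      fderiv ℝ (fderiv ℝ u) x (tangentVec 0) (tangentVec 0) :=
    funext fun x => laplacian_eq_fderiv_fderiv u x 0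
  rw [h3]
  exact ((h2.clm_apply continuous_const).clm_apply continuous_const).add
    ((h2.clm_apply continuous_const).clm_apply continuous_const)

/-- Bounds near the origin and bounds at infinity together give bounds on the plane. -/
lemma hasDecayingSolution_of_bounds {l : ℂ} {u : Plane → ℂ} (hu : ContDiff ℝ 2 u) (hne : u ≠ 0)
    {ρ C c : ℝ} (hρ : 1 ≤ ρ) (hC : 0 < C) (hc : 0 < c)
    (h1 : ∀ x, ‖x‖ ≤ ρ → ‖(Δ u) x + l * u x‖ ≤ C * ‖u x‖)
    (h2 : ∀ x, ρ ≤ ‖x‖ → ‖(Δ u) x + l * u x‖ ≤ C / √‖x‖ * ‖u x‖)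
    (h3 : ∀ x, ‖u x‖ ≤ C * ‖fderiv ℝ u x‖)
    (h4 : ∀ x, ρ ≤ ‖x‖ → ‖u x‖ ≤ C * Real.exp (-c * ‖x‖)) : HasDecayingSolution l := by
  refine ⟨u, hu, hne, ⟨C * (2 + ρ), by positivity, fun x => ?_⟩, ⟨C, hC, h3⟩, ?_⟩
  · rcases le_total ‖x‖ ρ with hx | hx
    · have hb : 1 / (1 + ρ) ≤ bracket x ^ (-(1 / 2) : ℝ) := by
        refine inv_le_bracket_rpow (by positivity) ((bracket_le_one_add_norm x).trans ?_)
        nlinarith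
      have : 1 ≤ (2 + ρ) * bracket x ^ (-(1 / 2) : ℝ) := by
        rw [div_le_iff₀ (by positivity)] at hb
        nlinarith [Real.rpow_nonneg (bracket_pos x).le (-(1 / 2) : ℝ)]
      refine (h1 x hx).trans (mul_le_mul_of_nonneg_right ?_ (norm_nonneg _))
      nlinarith
    · have hs : 1 ≤ √‖x‖ := Real.one_le_sqrt.2 (hρ.trans hx)
      have hss : √‖x‖ ^ 2 = ‖x‖ := Real.sq_sqrt (norm_nonneg x)
      have hb : 1 / (2 * √‖x‖) ≤ bracket x ^ (-(1 / 2) : ℝ) := by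
        refine inv_le_bracket_rpow (by positivity) ((bracket_le_one_add_norm x).trans ?_)
        nlinarith
      refine (h2 x hx).trans (mul_le_mul_of_nonneg_right ?_ (norm_nonneg _))
      have : 1 / √‖x‖ ≤ (2 + ρ) * bracket x ^ (-(1 / 2) : ℝ) := by
        have e : 1 / √‖x‖ = 2 * (1 / (2 * √‖x‖)) := by field_simp
        rw [e]
        nlinarith [Real.rpow_nonneg (bracket_pos x).le (-(1 / 2) : ℝ)]
      calc C / √‖x‖ = C * (1 / √‖x‖) := by ring
        _ ≤ C * ((2 + ρ) * bracket x ^ (-(1 / 2) : ℝ)) := mul_le_mul_of_nonneg_left this hC.le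
        _ = _ := by ring
  · obtain ⟨B, hB⟩ := (isCompact_closedBall (0 : Plane) ρ).exists_bound_of_continuousOn
      hu.continuous.continuousOn
    refine ⟨C + |B| * Real.exp (c * ρ), c, by positivity, hc, fun x => ?_⟩
    rcases le_total ‖x‖ ρ with hx | hx
    · have e1 : 1 ≤ Real.exp (c * ρ) * Real.exp (-c * ‖x‖) := by
        rw [← Real.exp_add]
        exact Real.one_le_exp (by nlinarith)
      have e2 := (hB x (by simpa using hx)).trans (le_abs_self B)
      have e3 := Real.exp_pos (-c * ‖x‖)
      calc ‖u x‖ ≤ |B| * 1 := by simpa using e2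
        _ ≤ |B| * (Real.exp (c * ρ) * Real.exp (-c * ‖x‖)) :=
          mul_le_mul_of_nonneg_left e1 (abs_nonneg B)
        _ ≤ _ := by nlinarith
    · refine (h4 x hx).trans (mul_le_mul_of_nonneg_right ?_ (Real.exp_pos _).le)
      have : 0 ≤ |B| * Real.exp (c * ρ) := by positivity
      linarith

/-- The potential is the quotient `(Δu + lu)/u`. At a zero of `u` the numerator vanishes as well, so
the convention `0/0 = 0` keeps the equation true there. -/
lemma HasDecayingSolution.exists_potential {l : ℂ} (h : HasDecayingSolution l) :
    ∃ V u : Plane → ℂ, Measurable V ∧ IsPotentialEigenfunction l V u ∧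
      (∃ C : ℝ, 0 < C ∧ ∀ x, ‖V x‖ ≤ C * bracket x ^ (-(1 / 2) : ℝ)) ∧
      DecaysExponentially u := by
  obtain ⟨u, hu, hne, ⟨C, hC, hF⟩, -, hd⟩ := h
  refine ⟨fun x => ((Δ u) x + l * u x) / u x, u, ?_, ⟨hu, hne, fun x => ?_⟩,
    ⟨C, hC, fun x => ?_⟩, hd⟩
  · exact ((continuous_laplacian hu).add (continuous_const.mul hu.continuous)).measurable.div
      hu.continuous.measurable
  · by_cases hx : u x = 0
    · have : (Δ u) x + l * u x = 0 :=
        norm_le_zero_iff.1 ((hF x).trans_eq (by rw [hx, norm_zero, mul_zero]))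
      rw [this, hx, mul_zero]
    · rw [div_mul_cancel₀ _ hx]
  · have hb := Real.rpow_nonneg (bracket_pos x).le (-(1 / 2) : ℝ)
    by_cases hx : u x = 0
    · simp only [hx, div_zero, norm_zero]; positivity
    · rw [norm_div, div_le_iff₀ (norm_pos_iff.2 hx)]
      exact hF x

/-- Take `W` parallel to the conjugate gradient, so that `W · ∇u` involves `|∇u|²` although the
product is bilinear. At a critical point the gradient bound gives `u = 0`, hence `Δu + lu = 0`, and
`W = 0` works. -/
lemma HasDecayingSolution.exists_drift {l : ℂ} (h : HasDecayingSolution l) :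
    ∃ (W : Plane → EuclideanSpace ℂ (Fin 2)) (u : Plane → ℂ), Measurable W ∧
      IsDriftEigenfunction l W u ∧
      (∃ C : ℝ, 0 < C ∧ ∀ x, ‖W x‖ ≤ C * bracket x ^ (-(1 / 2) : ℝ)) ∧
      DecaysExponentially u := by
  obtain ⟨u, hu, hne, ⟨C, hC, hF⟩, ⟨C', hC', hG⟩, hd⟩ := h
  let g : Plane → EuclideanSpace ℂ (Fin 2) := fun x =>
    WithLp.toLp 2 fun i => fderiv ℝ u x (EuclideanSpace.single i (1 : ℝ))
  have hDc : Continuous (fderiv ℝ u) := hu.continuous_fderiv (by simp)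
  have hgi : ∀ i : Fin 2, Continuous fun x => fderiv ℝ u x (EuclideanSpace.single i (1 : ℝ)) :=
    fun i => hDc.clm_apply continuous_const
  have hgn : ∀ x, ‖fderiv ℝ u x‖ ≤ 2 * ‖g x‖ := fun x => by
    refine ContinuousLinearMap.opNorm_le_bound _ (by positivity) fun v => ?_
    have e : v = v 0 • EuclideanSpace.single (0 : Fin 2) (1 : ℝ) +
        v 1 • EuclideanSpace.single (1 : Fin 2) (1 : ℝ) := by
      ext i; fin_cases i <;> simp
    have e0 : ‖fderiv ℝ u x (EuclideanSpace.single 0 (1 : ℝ))‖ ≤ ‖g x‖ :=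
      PiLp.norm_apply_le (g x) 0
    have e1 : ‖fderiv ℝ u x (EuclideanSpace.single 1 (1 : ℝ))‖ ≤ ‖g x‖ :=
      PiLp.norm_apply_le (g x) 1
    have f0 : ‖v 0‖ ≤ ‖v‖ := PiLp.norm_apply_le v 0
    have f1 : ‖v 1‖ ≤ ‖v‖ := PiLp.norm_apply_le v 1
    conv_lhs => rw [e, map_add, map_smul, map_smul]
    refine (norm_add_le _ _).trans ?_
    rw [norm_smul, norm_smul]
    have := mul_le_mul f0 e0 (norm_nonneg _) (norm_nonneg _)
    have := mul_le_mul f1 e1 (norm_nonneg _) (norm_nonneg _)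
    linarith
  let W : Plane → EuclideanSpace ℂ (Fin 2) := fun x =>
    WithLp.toLp 2 fun i => starRingEnd ℂ (g x i) * (((Δ u) x + l * u x) / (‖g x‖ ^ 2 : ℝ))
  have hWn : ∀ x, ‖W x‖ = ‖g x‖ * (‖(Δ u) x + l * u x‖ / ‖g x‖ ^ 2) := fun x => by
    have : W x = (((Δ u) x + l * u x) / (‖g x‖ ^ 2 : ℝ)) •
        (WithLp.toLp 2 fun i => starRingEnd ℂ (g x i) : EuclideanSpace ℂ (Fin 2)) := by
      ext i; simp [W, mul_comm]
    rw [this, norm_smul, norm_div, mul_comm]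
    congr 1
    · simp [EuclideanSpace.norm_eq]
    · rw [Complex.norm_real, Real.norm_of_nonneg (by positivity)]
  have hFg : ∀ x, ‖(Δ u) x + l * u x‖ ≤ C * bracket x ^ (-(1 / 2) : ℝ) * (C' * (2 * ‖g x‖)) :=
    fun x => (hF x).trans (mul_le_mul_of_nonneg_left
      ((hG x).trans (mul_le_mul_of_nonneg_left (hgn x) hC'.le))
      (mul_nonneg hC.le (Real.rpow_nonneg (bracket_pos x).le _)))
  refine ⟨W, u, ?_, ⟨hu, hne, fun x => ?_⟩, ⟨2 * C * C', by positivity, fun x => ?_⟩, hd⟩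
  · have hF' : Continuous fun x => (Δ u) x + l * u x :=
      (continuous_laplacian hu).add (continuous_const.mul hu.continuous)
    have hg : Continuous g :=
      (PiLp.continuous_toLp 2 (fun _ : Fin 2 => ℂ)).comp (continuous_pi hgi)
    refine (WithLp.measurable_toLp 2 (Fin 2 → ℂ)).comp (measurable_pi_lambda _ fun i => ?_)
    refine Measurable.mul (Complex.continuous_conj.comp (hgi i)).measurable (Measurable.div
      hF'.measurable ?_)
    exact (Complex.continuous_ofReal.comp (hg.norm.pow 2)).measurable
  · have e : driftTerm W u x = (∑ i, (‖g x i‖ ^ 2 : ℝ)) *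
        (((Δ u) x + l * u x) / (‖g x‖ ^ 2 : ℝ)) := by
      rw [driftTerm]
      push_cast
      rw [Finset.sum_mul]
      refine Finset.sum_congr rfl fun i _ => ?_
      have : ((‖g x i‖ : ℂ)) ^ 2 = starRingEnd ℂ (g x i) * g x i := by
        rw [Complex.conj_mul']
      rw [this]
      simp only [W, g]
      push_cast
      ring
    rw [e, ← EuclideanSpace.norm_sq_eq]
    by_cases hx : ‖g x‖ = 0
    · have := hFg x
      rw [hx, mul_zero, mul_zero, mul_zero, norm_le_zero_iff] at this
      rw [this]; simp
    · have : ((‖g x‖ ^ 2 : ℝ) : ℂ) ≠ 0 := by exact_mod_cast pow_ne_zero 2 hx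
      rw [mul_div_cancel₀ _ this]
  · rw [hWn]
    have hb := Real.rpow_nonneg (bracket_pos x).le (-(1 / 2) : ℝ)
    by_cases hx : ‖g x‖ = 0
    · rw [hx]; simp only [zero_mul]; positivity
    · have hx' : 0 < ‖g x‖ := lt_of_le_of_ne (norm_nonneg _) (Ne.symm hx)
      have e : ‖g x‖ * (‖(Δ u) x + l * u x‖ / ‖g x‖ ^ 2) =
        ‖(Δ u) x + l * u x‖ / ‖g x‖ := by field_simp
      rw [e, div_le_iff₀ hx']
      refine (hFg x).trans (le_of_eq (by ring))

/-! ### The core wave near the origin -/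

/-- The identification of the plane with `ℂ`. -/
noncomputable def toComplex : Plane →L[ℝ] ℂ :=
  Complex.ofRealCLM.comp (EuclideanSpace.proj 0 : Plane →L[ℝ] ℝ) +
    Complex.I • Complex.ofRealCLM.comp (EuclideanSpace.proj 1 : Plane →L[ℝ] ℝ)

lemma toComplex_apply (x : Plane) : toComplex x = x 0 + Complex.I * x 1 := by
  simp [toComplex]

lemma toComplex_polar (r θ : ℝ) : toComplex (polar r θ) = r * Complex.exp (Complex.I * θ) := by
  rw [toComplex_apply, mul_comm Complex.I (θ : ℂ), Complex.exp_mul_I]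
  simp only [polar, PiLp.toLp_apply, Matrix.cons_val_zero, Matrix.cons_val_one]
  push_cast
  ring

lemma norm_toComplex (x : Plane) : ‖toComplex x‖ = ‖x‖ := by
  obtain ⟨θ, hθ⟩ := exists_polar x
  have : ‖toComplex x‖ = ‖(‖x‖ : ℂ) * Complex.exp (Complex.I * θ)‖ := by
    rw [← toComplex_polar, ← hθ]
  rw [this, norm_mul, mul_comm Complex.I, Complex.norm_exp_ofReal_mul_I, mul_one,
    Complex.norm_real, norm_norm]

lemma toComplex_eq_unitPhase {x : Plane} (hx : x ≠ 0) :
    toComplex x = ‖x‖ * unitPhase 1 x := by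
  have : (‖x‖ : ℂ) ≠ 0 := by exact_mod_cast norm_ne_zero_iff.2 hx
  rw [toComplex_apply, unitPhase]
  field_simp
  push_cast
  ring

/-- Holomorphic functions are harmonic: the two second derivatives differ by the factor `I² = -1`.
-/
lemma laplacian_toComplex_pow (n : ℕ) (x : Plane) : (Δ fun y => toComplex y ^ n) x = 0 := by
  have d : ∀ (k : ℕ) (y : Plane), HasFDerivAt (fun y => toComplex y ^ k)
      ((k * toComplex y ^ (k - 1)) • toComplex) y := fun k y => by
    have h := (toComplex.hasFDerivAt (x := y)).pow k
    refine h.congr_fderiv ?_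
    ext v
    simp
  have d1 : fderiv ℝ (fun y => toComplex y ^ n) =
      fun y => ((n : ℂ) * toComplex y ^ (n - 1)) • toComplex := funext fun y => (d n y).fderiv
  have d2 := (((d (n - 1) x).const_mul (n : ℂ)).smul_const toComplex).fderiv
  rw [laplacian_eq_fderiv_fderiv _ x 0, d1, d2]
  have e1 : toComplex (radialVec 0) = 1 := by simp [toComplex_apply, radialVec]
  have e2 : toComplex (tangentVec 0) = Complex.I := by simp [toComplex_apply, tangentVec]
  simp only [ContinuousLinearMap.smulRight_apply, smul_apply, smul_eq_mul, e1, e2]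
  linear_combination ((n : ℂ) * (↑(n - 1) * toComplex x ^ (n - 1 - 1))) * Complex.I_sq

/-- A smooth function which is `z^n` near the origin and `|x|^{1/2} exp(-A |x|) (z/|z|)^n` for
`|x| ≥ 1`. -/
noncomputable def coreWave (A : ℂ) (n : ℕ) (x : Plane) : ℂ :=
  toComplex x ^ n * Complex.exp (Real.smoothTransition (2 * ‖x‖ - 1) *
    ((1 / 2 - n) * Real.log ‖x‖ - A * ‖x‖))

lemma coreWave_eventuallyEq_pow (A : ℂ) (n : ℕ) {x : Plane} (hx : ‖x‖ < 1 / 2) :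
    coreWave A n =ᶠ[𝓝 x] fun y => toComplex y ^ n := by
  filter_upwards [continuous_norm.continuousAt.eventually_lt_const hx] with y hy
  rw [coreWave, Real.smoothTransition.zero_of_nonpos (by linarith)]
  simp

lemma coreWave_ne_zero (A : ℂ) (n : ℕ) {x : Plane} (hx : x ≠ 0) : coreWave A n x ≠ 0 := by
  refine mul_ne_zero (pow_ne_zero _ ?_) (Complex.exp_ne_zero _)
  rw [← norm_ne_zero_iff, norm_toComplex]
  exact norm_ne_zero_iff.2 hx

lemma contDiff_coreWave (A : ℂ) (n : ℕ) : ContDiff ℝ 2 (coreWave A n) := by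
  refine contDiff_iff_contDiffAt.2 fun x => ?_
  rcases eq_or_ne x 0 with rfl | hx
  · exact (toComplex.contDiff.pow n).contDiffAt.congr_of_eventuallyEq
      (coreWave_eventuallyEq_pow A n (by simp))
  · have hn : ContDiffAt ℝ 2 (fun x : Plane => ‖x‖) x := contDiffAt_norm ℝ hx
    have hc : ∀ {f : Plane → ℝ}, ContDiffAt ℝ 2 f x → ContDiffAt ℝ 2 (fun x => (f x : ℂ)) x :=
      fun hf => Complex.ofRealCLM.contDiff.contDiffAt.comp x hf
    have hs : ContDiffAt ℝ 2 (fun x : Plane => Real.smoothTransition (2 * ‖x‖ - 1)) x :=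
      (Real.smoothTransition.contDiffAt (n := 2)).comp x
        ((contDiffAt_const.mul hn).sub contDiffAt_const)
    unfold coreWave
    exact (toComplex.contDiff.pow n).contDiffAt.mul ((hc hs).mul
      ((contDiffAt_const.mul (hc (hn.log (norm_ne_zero_iff.2 hx)))).sub
        (contDiffAt_const.mul (hc hn)))).cexp

lemma coreWave_eq_weight (A : ℂ) (n : ℕ) {x : Plane} (hx : 1 ≤ ‖x‖) :
    coreWave A n x = weight A √‖x‖ * unitPhase 1 x ^ n := by
  have hpos : 0 < ‖x‖ := by linarith
  have h0 : (‖x‖ : ℂ) ≠ 0 := by exact_mod_cast hpos.ne'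
  have h1 : ((√‖x‖ : ℝ) : ℂ) = Complex.exp (1 / 2 * Real.log ‖x‖) := by
    rw [Real.sqrt_eq_rpow, Real.rpow_def_of_pos hpos]; push_cast; congr 1; ring
  have h2 : ((√‖x‖ : ℝ) : ℂ) ^ 2 = ‖x‖ := by
    exact_mod_cast Real.sq_sqrt hpos.le
  have h3 : (‖x‖ : ℂ) ^ n = Complex.exp (n * Real.log ‖x‖) := by
    rw [Complex.exp_nat_mul, Complex.ofReal_log hpos.le, Complex.exp_log h0]
  rw [coreWave, Real.smoothTransition.one_of_one_le (by linarith),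
    toComplex_eq_unitPhase (norm_pos_iff.1 hpos), weight, h2, h1, mul_pow, h3]
  have h4 : Complex.exp (((1 : ℝ) : ℂ) * ((1 / 2 - n) * Real.log ‖x‖ - A * ‖x‖)) *
      Complex.exp (n * Real.log ‖x‖) = Complex.exp (1 / 2 * Real.log ‖x‖) *
        Complex.exp (-A * ‖x‖) := by
    rw [← Complex.exp_add, ← Complex.exp_add]; congr 1; push_cast; ring
  linear_combination (unitPhase 1 x ^ n) * h4

lemma coreWave_eq_twoWave (A : ℂ) (n : ℕ) {x : Plane} (hx : 1 ≤ ‖x‖) :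
    coreWave A n x = twoWave A 1 n 0 (fun _ => 1) (fun _ => 0) (fun _ => 0) (fun _ => 0)
      (fun _ => 0) x := by
  rw [coreWave_eq_weight A n hx, twoWave]
  simp

/-- The angular derivative is `i n u`, of size at least `|u|` as soon as `n ≥ 1`. This is why the
core must rotate. -/
lemma norm_le_norm_fderiv_coreWave (A : ℂ) {n : ℕ} (hn : 1 ≤ n) (x : Plane) :
    ‖coreWave A n x‖ ≤ ‖x‖ * ‖fderiv ℝ (coreWave A n) x‖ := by
  obtain ⟨θ, hθ⟩ := exists_polar x
  set r := ‖x‖ with hr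
  have hpol : ∀ a : ℝ, coreWave A n (polar r a) = (r : ℂ) ^ n *
      Complex.exp (Real.smoothTransition (2 * r - 1) * ((1 / 2 - n) * Real.log r - A * r)) *
        Complex.exp (n * (Complex.I * a)) := fun a => by
    rw [coreWave, toComplex_polar, norm_polar (norm_nonneg x), mul_pow, Complex.exp_nat_mul]
    ring
  have h1 : HasDerivAt (fun a : ℝ => coreWave A n (polar r a))
      (n * Complex.I * coreWave A n (polar r θ)) θ := by
    have hid : HasDerivAt (fun a : ℝ => (a : ℂ)) 1 θ := (hasDerivAt_id θ).ofReal_comp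
    rw [funext hpol, hpol]
    exact ((((hid.const_mul Complex.I).const_mul (n : ℂ)).cexp).const_mul _).congr_deriv (by ring)
  have h2 : HasDerivAt (fun a : ℝ => polar r a) (r • tangentVec θ) θ := by
    simp_rw [polar_eq_smul]
    exact (hasDerivAt_radialVec θ).const_smul r
  have h3 := (((contDiff_coreWave A n).differentiable (by simp) (polar r θ)).hasFDerivAt).comp_hasDerivAt
    θ h2
  have h4 := h1.unique h3
  have h5 := (fderiv ℝ (coreWave A n) (polar r θ)).le_opNorm (r • tangentVec θ)
  rw [← h4, norm_smul, norm_tangentVec, ← hθ, norm_mul, norm_mul, Complex.norm_I,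
    Complex.norm_natCast, Real.norm_of_nonneg (norm_nonneg x)] at h5
  have : (1 : ℝ) ≤ n := by exact_mod_cast hn
  nlinarith [norm_nonneg (coreWave A n x)]

/-- On bounded sets, `Δ + l` applied to the core wave is bounded by the core wave. -/
lemma exists_bound_coreWave (A l : ℂ) (n : ℕ) (ρ : ℝ) : ∃ C : ℝ, 0 < C ∧ ∀ x : Plane, ‖x‖ ≤ ρ →
    ‖(Δ (coreWave A n)) x + l * coreWave A n x‖ ≤ C * ‖coreWave A n x‖ := by
  have hu := contDiff_coreWave A n
  have hF : Continuous fun x => (Δ (coreWave A n)) x + l * coreWave A n x :=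
    (continuous_laplacian hu).add (continuous_const.mul hu.continuous)
  have hnear : ∀ x : Plane, ‖x‖ < 1 / 2 → (Δ (coreWave A n)) x = 0 := fun x hx =>
    (InnerProductSpace.laplacian_congr_nhds (coreWave_eventuallyEq_pow A n hx)).eq_of_nhds.trans
      (laplacian_toComplex_pow n x)
  have hne : ∀ x : Plane, x ≠ 0 → coreWave A n x ≠ 0 := fun x => coreWave_ne_zero A n
  have huc := hu.continuous
  generalize coreWave A n = u at *
  generalize Δ u = v at *
  -- The removed ball lies inside `|x| < 1/2`, where the wave is harmonic and only `l u` remains.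
  -- Outside it the wave has no zero, and compactness bounds the quotient.
  have hK : IsCompact (Metric.closedBall (0 : Plane) ρ \ Metric.ball 0 (1 / 4)) :=
    (isCompact_closedBall _ _).diff Metric.isOpen_ball
  have hK0 : ∀ x ∈ Metric.closedBall (0 : Plane) ρ \ Metric.ball 0 (1 / 4), u x ≠ 0 :=
    fun x hx => hne x fun h => by
      rw [h] at hx
      exact hx.2 (Metric.mem_ball_self (by norm_num))
  obtain ⟨B, hB⟩ := hK.exists_bound_of_continuousOn (hF.continuousOn.div huc.continuousOn hK0)
  refine ⟨‖l‖ + |B| + 1, by positivity, fun x hx => ?_⟩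
  by_cases hx' : ‖x‖ < 1 / 4
  · rw [hnear x (by linarith), zero_add, norm_mul]
    exact mul_le_mul_of_nonneg_right (by linarith [abs_nonneg B]) (norm_nonneg _)
  · have hxK : x ∈ Metric.closedBall (0 : Plane) ρ \ Metric.ball 0 (1 / 4) :=
      ⟨by simpa using hx, by simpa using hx'⟩
    have h : ‖(v x + l * u x) / u x‖ ≤ B := hB x hxK
    rw [norm_div, div_le_iff₀ (norm_pos_iff.2 (hK0 x hxK))] at h
    refine h.trans (mul_le_mul_of_nonneg_right ?_ (norm_nonneg _))
    linarith [norm_nonneg l, le_abs_self B]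

/-! ### Bounds for a single wave, and the case of `l` outside `[0, ∞)` -/

lemma hasTwoDerivs_const (c : ℝ) : HasTwoDerivs (fun _ => c) (fun _ => 0) (fun _ => 0) :=
  fun a _ => ⟨hasDerivAt_const a c, hasDerivAt_const a 0⟩

lemma norm_weight (A : ℂ) {t : ℝ} (ht : 0 ≤ t) : ‖weight A t‖ = t * Real.exp (-A.re * t ^ 2) := by
  rw [weight, norm_mul, Complex.norm_exp, Complex.norm_real, Real.norm_of_nonneg ht]
  congr 2
  rw [← Complex.ofReal_pow, Complex.re_mul_ofReal, Complex.neg_re]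

/-- The term with `b` is `O(1/t)` by assumption, the drift carries `A/t`, and all the rest is
divided by `4t²`. -/
lemma norm_waveCoeff_le {A α α' α'' p p' b : ℂ} {t K : ℝ} (ht : 1 ≤ t) (hK : 1 ≤ K)
    (hA : ‖A‖ ≤ K) (hα : ‖α‖ ≤ 1) (hα' : ‖α'‖ ≤ K) (hα'' : ‖α''‖ ≤ K) (hp : ‖p‖ ≤ K)
    (hp' : ‖p'‖ ≤ K) (hb : ‖b‖ ≤ K / t) : ‖waveCoeff A t α α' α'' p p' b‖ ≤ 8 * K ^ 2 / t := by
  have ht0 : 0 < t := by linarith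
  have hK0 : 0 ≤ K := by linarith
  have htn : ‖(t : ℂ)‖ = t := by rw [Complex.norm_real, Real.norm_of_nonneg ht0.le]
  have hαp : ‖α' + α * p‖ ≤ 2 * K := by
    refine (norm_add_le _ _).trans ?_
    rw [norm_mul]
    nlinarith [mul_le_mul hα hp (norm_nonneg _) zero_le_one]
  have h1 : ‖α * b‖ ≤ K / t := by
    rw [norm_mul]
    simpa using mul_le_mul hα hb (norm_nonneg _) zero_le_one
  have h2 : ‖A / t * (α' + α * p)‖ ≤ 2 * K ^ 2 / t := by
    rw [norm_mul, norm_div, htn, div_mul_eq_mul_div]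
    refine div_le_div_of_nonneg_right ?_ ht0.le
    nlinarith [mul_le_mul hA hαp (norm_nonneg _) hK0]
  have h3 : ‖α'' + 2 * α' * p + α * (p' + p ^ 2) + 3 * (α' + α * p) / t +
      (1 / t ^ 2 - 8 * A) * α‖ ≤ 20 * K ^ 2 := by
    have e1 : ‖2 * α' * p‖ ≤ 2 * K ^ 2 := by
      rw [norm_mul, norm_mul, Complex.norm_ofNat]
      nlinarith [mul_le_mul hα' hp (norm_nonneg _) hK0]
    have e2 : ‖α * (p' + p ^ 2)‖ ≤ K + K ^ 2 := by
      rw [norm_mul]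
      have : ‖p' + p ^ 2‖ ≤ K + K ^ 2 := by
        refine (norm_add_le _ _).trans (add_le_add hp' ?_)
        rw [norm_pow]; gcongr
      simpa using mul_le_mul hα this (norm_nonneg _) zero_le_one
    have e3 : ‖3 * (α' + α * p) / t‖ ≤ 6 * K := by
      rw [norm_div, norm_mul, htn, Complex.norm_ofNat, div_le_iff₀ ht0]
      nlinarith
    have e4 : ‖(1 / (t : ℂ) ^ 2 - 8 * A) * α‖ ≤ 1 + 8 * K := by
      rw [norm_mul]
      have : ‖1 / (t : ℂ) ^ 2 - 8 * A‖ ≤ 1 + 8 * K := by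
        refine (norm_sub_le _ _).trans (add_le_add ?_ ?_)
        · rw [norm_div, norm_pow, htn, norm_one, div_le_one (by positivity)]
          exact one_le_pow₀ ht
        · rw [norm_mul, Complex.norm_ofNat]; gcongr
      simpa using mul_le_mul this hα (norm_nonneg _) (by positivity)
    refine (norm_add_le _ _).trans ?_
    refine (add_le_add ((norm_add_le _ _).trans (add_le_add ((norm_add_le _ _).trans
      (add_le_add ((norm_add_le _ _).trans (add_le_add hα'' e1)) e2)) e3)) e4).trans ?_
    nlinarith
  have h4 : ‖(α'' + 2 * α' * p + α * (p' + p ^ 2) + 3 * (α' + α * p) / t +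
      (1 / t ^ 2 - 8 * A) * α) / (4 * t ^ 2)‖ ≤ 5 * K ^ 2 / t := by
    rw [norm_div, norm_mul, norm_pow, htn, Complex.norm_ofNat, div_le_div_iff₀ (by positivity) ht0]
    have : t ≤ t ^ 2 := by nlinarith
    nlinarith [mul_le_mul h3 this ht0.le (by positivity)]
  rw [waveCoeff]
  refine ((norm_add_le _ _).trans (add_le_add ((norm_sub_le _ _).trans (add_le_add h1 h2))
    h4)).trans ?_
  rw [← add_div, ← add_div]
  gcongr
  nlinarith

/-- Half of the exponential absorbs the factor `t`. -/
lemma mul_exp_neg_sq_le {a t : ℝ} (ha : 0 < a) (ht : 1 ≤ t) :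
    t * Real.exp (-a * t ^ 2) ≤ 2 / a * Real.exp (-(a / 2) * t ^ 2) := by
  have h1 : a / 2 * t ≤ Real.exp (a / 2 * t ^ 2) := by
    have := Real.add_one_le_exp (a / 2 * t ^ 2)
    nlinarith [mul_pos ha (by linarith : 0 < t)]
  have h2 : Real.exp (-(a / 2) * t ^ 2) = Real.exp (a / 2 * t ^ 2) * Real.exp (-a * t ^ 2) := by
    rw [← Real.exp_add]; congr 1; ring
  rw [h2, ← mul_assoc]
  refine mul_le_mul_of_nonneg_right ?_ (Real.exp_pos _).le
  rw [div_mul_eq_mul_div, le_div_iff₀ ha]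
  nlinarith

lemma norm_unitPhase {x : Plane} (hx : x ≠ 0) : ‖unitPhase 1 x‖ = 1 := by
  have := congrArg norm (toComplex_eq_unitPhase hx)
  rw [norm_toComplex, norm_mul, Complex.norm_real, norm_norm] at this
  exact (mul_eq_left₀ (norm_ne_zero_iff.2 hx)).1 this.symm

lemma norm_coreWave (A : ℂ) (n : ℕ) {x : Plane} (hx : 1 ≤ ‖x‖) :
    ‖coreWave A n x‖ = √‖x‖ * Real.exp (-A.re * √‖x‖ ^ 2) := by
  rw [coreWave_eq_weight A n hx, norm_mul, norm_pow,
    norm_unitPhase (norm_pos_iff.1 (by linarith)), one_pow, mul_one,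
    norm_weight A (Real.sqrt_nonneg _)]

/-- The core wave solves the equation up to `O(1/r)` when `A² = -l`. -/
lemma hasDecayingSolution_of_sq {l A : ℂ} (hA : A ^ 2 = -l) (hre : 0 < A.re) :
    HasDecayingSolution l := by
  have hA0 : 0 < ‖A‖ := norm_pos_iff.2 fun h => by simp [h] at hre
  -- For `t² ≥ 1/‖A‖` one has `1/t ≤ ‖A‖ t`, so the logarithmic derivative `1/t - 2At` of the weight
  -- has size at least `‖A‖ t`.
  set ρ := 2 + 1 / ‖A‖ with hρ
  have hρ2 : 2 ≤ ρ := le_add_of_nonneg_right (by positivity)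
  obtain ⟨C₁, hC₁, h₁⟩ := exists_bound_coreWave A l 1 ρ
  set K := 2 + ‖A‖ with hK
  have hfar : ∀ x, ρ ≤ ‖x‖ →
      ‖(Δ (coreWave A 1)) x + l * coreWave A 1 x‖ ≤ (8 * K ^ 2) / √‖x‖ * ‖coreWave A 1 x‖ ∧
      ‖coreWave A 1 x‖ ≤ 2 / ‖A‖ * ‖fderiv ℝ (coreWave A 1) x‖ := by
    intro x hx
    obtain ⟨θ, hθ⟩ := exists_polar x
    have hx1 : 1 < ‖x‖ := by linarith
    have hx0 : x ≠ 0 := norm_pos_iff.1 (by linarith)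
    obtain ⟨t, ht⟩ : ∃ t, t = √‖x‖ := ⟨_, rfl⟩
    have ht2 : t ^ 2 = ‖x‖ := by rw [ht, Real.sq_sqrt (norm_nonneg x)]
    have ht1 : 1 ≤ t := by rw [ht]; exact Real.one_le_sqrt.2 hx1.le
    have ht0 : 0 < t := by linarith
    have htn : ‖(t : ℂ)‖ = t := by rw [Complex.norm_real, Real.norm_of_nonneg ht0.le]
    have hev : coreWave A 1 =ᶠ[𝓝 x] twoWave A 1 1 0 (fun _ => 1) (fun _ => 0) (fun _ => 0)
        (fun _ => 0) (fun _ => 0) := by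
      filter_upwards [continuous_norm.continuousAt.eventually_const_lt hx1] with y hy
      exact coreWave_eq_twoWave A 1 hy.le
    have hn := norm_coreWave A 1 hx1.le
    rw [InnerProductSpace.laplacian_congr_nhds hev |>.eq_of_nhds, hev.fderiv_eq, hn, ← ht,
      hev.eq_of_nhds]
    rw [← ht2] at hθ
    obtain ⟨k1, k2, -⟩ := twoWave_formulas (A := A) (l := l) (σ := 1) (Or.inl rfl) (n := 1)
      (n' := 0) (hasTwoDerivs_const 1) (hasTwoDerivs_const 0) (hasTwoDerivs_const 0)
      (hasTwoDerivs_const 0) (hasTwoDerivs_const 0) ht0 (θ := θ) (ϑ := 1 * θ) rfl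
      (contDiffAt_twoWave A 1 1 0 contDiffOn_const contDiffOn_const contDiffOn_const
        contDiffOn_const contDiffOn_const (hθ ▸ hx0)) rfl rfl rfl rfl rfl rfl rfl rfl rfl
    rw [← hθ] at k1 k2
    have hexp : ∀ y : ℝ, ‖Complex.exp (((0 : ℝ) : ℂ) + Complex.I * ((1 : ℕ) * (y : ℂ)))‖ = 1 := by
      intro y
      rw [show (((0 : ℝ) : ℂ) + Complex.I * ((1 : ℕ) * (y : ℂ))) = y * Complex.I by push_cast; ring,
        Complex.norm_exp_ofReal_mul_I]
    constructor
    · have hw : ∀ b p p' : ℂ, waveCoeff A t ((0 : ℝ) : ℂ) ((0 : ℝ) : ℂ) ((0 : ℝ) : ℂ) p p' b = 0 := by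
        intro b p p'; simp [waveCoeff]
      rw [k1, hw, mul_zero, add_zero, norm_mul, norm_mul, norm_weight A ht0.le, hexp, one_mul,
        mul_comm]
      refine mul_le_mul_of_nonneg_right ?_ (by positivity)
      refine norm_waveCoeff_le ht1 (by linarith) (by linarith) (by simp) (by simp; linarith)
        (by simp; linarith) (by simp; linarith) (by simp; linarith) ?_
      rw [hA, neg_add_cancel, zero_add]
      simp only [norm_div, norm_pow, norm_mul, Complex.norm_I, htn]
      rw [div_le_div_iff₀ (by positivity) ht0]
      have : t ≤ t ^ 4 := le_self_pow₀ ht1 (by norm_num)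
      simp only [Nat.cast_one, norm_one, mul_one, one_pow, one_mul]
      nlinarith
    · simp only [Complex.ofReal_zero, zero_mul, mul_zero, add_zero, Complex.ofReal_one, one_mul,
        zero_add] at k2
      have h0 := hexp θ
      simp only [Complex.ofReal_zero, zero_add] at h0
      rw [norm_mul, norm_mul, h0, mul_one, norm_weight A ht0.le] at k2
      have h5 : ‖A‖ * t ≤ ‖1 / (t : ℂ) - 2 * A * t‖ := by
        have h6 := norm_sub_norm_le (2 * A * (t : ℂ)) (1 / t)
        rw [norm_sub_rev, norm_mul, norm_mul, norm_div, norm_one, htn, Complex.norm_ofNat] at h6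
        have h7 : 1 / t ≤ ‖A‖ * t := by
          rw [div_le_iff₀ ht0]
          have h8 : 1 / ‖A‖ ≤ t ^ 2 := by linarith
          rw [div_le_iff₀ hA0] at h8
          nlinarith
        linarith
      rw [div_mul_eq_mul_div, le_div_iff₀ hA0]
      have h9 := (mul_le_mul_of_nonneg_left h5 (by positivity :
        0 ≤ t * Real.exp (-A.re * t ^ 2))).trans k2
      have h10 : t * (t * Real.exp (-A.re * t ^ 2) * ‖A‖) ≤
        t * (2 * ‖fderiv ℝ (twoWave A 1 1 0 (fun _ => 1) (fun _ => 0) (fun _ => 0)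
          (fun _ => 0) (fun _ => 0)) x‖) := by linarith
      exact le_of_mul_le_mul_left h10 ht0
  have hKp : 0 < K := by positivity
  refine hasDecayingSolution_of_bounds (contDiff_coreWave A 1) (fun h => ?_) (ρ := ρ)
    (C := C₁ + 8 * K ^ 2 + 2 / ‖A‖ + ρ + 2 / A.re) (c := A.re / 2) (by linarith) (by positivity)
    (by positivity) (fun x hx => ?_) (fun x hx => ?_) (fun x => ?_) (fun x hx => ?_)
  · exact coreWave_ne_zero A 1 (x := radialVec 0)
      (norm_pos_iff.1 (by rw [norm_radialVec]; exact one_pos)) (congrFun h _)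
  · refine (h₁ x hx).trans (mul_le_mul_of_nonneg_right ?_ (norm_nonneg _))
    have : 0 ≤ 8 * K ^ 2 + 2 / ‖A‖ + ρ + 2 / A.re := by positivity
    linarith
  · refine (hfar x hx).1.trans (mul_le_mul_of_nonneg_right (div_le_div_of_nonneg_right ?_
      (Real.sqrt_nonneg _)) (norm_nonneg _))
    have : 0 ≤ C₁ + 2 / ‖A‖ + ρ + 2 / A.re := by positivity
    linarith
  · rcases le_total ‖x‖ ρ with hx | hx
    · refine (norm_le_norm_fderiv_coreWave A le_rfl x).trans
        (mul_le_mul_of_nonneg_right (hx.trans ?_) (norm_nonneg _))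
      have : 0 ≤ C₁ + 8 * K ^ 2 + 2 / ‖A‖ + 2 / A.re := by positivity
      linarith
    · refine (hfar x hx).2.trans (mul_le_mul_of_nonneg_right ?_ (norm_nonneg _))
      have : 0 ≤ C₁ + 8 * K ^ 2 + ρ + 2 / A.re := by positivity
      linarith
  · rw [norm_coreWave A 1 (by linarith)]
    refine (mul_exp_neg_sq_le hre (Real.one_le_sqrt.2 (by linarith))).trans ?_
    rw [Real.sq_sqrt (norm_nonneg x)]
    refine mul_le_mul_of_nonneg_right ?_ (Real.exp_pos _).le
    have : 0 ≤ C₁ + 8 * K ^ 2 + 2 / ‖A‖ + ρ := by positivity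
    linarith

/-- A square root of `-l` with zero real part would make `l = -A²` a nonnegative real number;
otherwise one of the two roots has positive real part. -/
lemma exists_sqrt_neg {l : ℂ} (h : ¬ (l.im = 0 ∧ 0 ≤ l.re)) : ∃ A : ℂ, A ^ 2 = -l ∧ 0 < A.re := by
  obtain ⟨A, hA⟩ := IsAlgClosed.exists_pow_nat_eq (-l) (n := 2) (by norm_num)
  rcases lt_trichotomy A.re 0 with h1 | h1 | h1
  · exact ⟨-A, by rw [neg_sq, hA], by simpa using h1⟩
  · refine absurd ?_ h
    have e : l = -A ^ 2 := by rw [hA, neg_neg]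
    rw [e]
    simp [sq, h1, mul_self_nonneg]
  · exact ⟨A, hA, h1⟩

/-! ### Cutoffs and the parameters of a block -/

/-- A smooth cutoff: `1` for `s ≤ 2/3` and `0` for `5/6 ≤ s`. -/
noncomputable def cutoff (s : ℝ) : ℝ := Real.smoothTransition (5 - 6 * s)

lemma cutoff_nonneg (s : ℝ) : 0 ≤ cutoff s := Real.smoothTransition.nonneg _

lemma cutoff_le_one (s : ℝ) : cutoff s ≤ 1 := Real.smoothTransition.le_one _

lemma cutoff_eq_one {s : ℝ} (hs : s ≤ 2 / 3) : cutoff s = 1 :=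
  Real.smoothTransition.one_of_one_le (by linarith)

lemma cutoff_eq_zero {s : ℝ} (hs : 5 / 6 ≤ s) : cutoff s = 0 :=
  Real.smoothTransition.zero_of_nonpos (by linarith)

lemma contDiff_cutoff : ContDiff ℝ 2 cutoff :=
  (Real.smoothTransition.contDiff (n := 2)).comp (contDiff_const.sub (contDiff_const.mul contDiff_id))

lemma hasDerivAt_cutoff (s : ℝ) : HasDerivAt cutoff (deriv cutoff s) s :=
  (contDiff_cutoff.differentiable (by simp) s).hasDerivAt

lemma contDiff_deriv_cutoff : ContDiff ℝ 1 (deriv cutoff) :=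
  ((contDiff_succ_iff_deriv (n := 1)).1 contDiff_cutoff).2.2

lemma hasDerivAt_deriv_cutoff (s : ℝ) : HasDerivAt (deriv cutoff) (deriv (deriv cutoff) s) s :=
  (contDiff_deriv_cutoff.differentiable (by simp) s).hasDerivAt

lemma deriv_cutoff_eq_zero {s : ℝ} (hs : s < 2 / 3) : deriv cutoff s = 0 := by
  have : cutoff =ᶠ[𝓝 s] fun _ => 1 :=
    mem_of_superset (Iio_mem_nhds hs) fun y hy => cutoff_eq_one (le_of_lt hy)
  rw [this.deriv_eq, deriv_const]

lemma deriv_deriv_cutoff_eq_zero {s : ℝ} (hs : s < 2 / 3) : deriv (deriv cutoff) s = 0 := by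
  have : deriv cutoff =ᶠ[𝓝 s] fun _ => 0 :=
    mem_of_superset (Iio_mem_nhds hs) fun y hy => deriv_cutoff_eq_zero hy
  rw [this.deriv_eq, deriv_const]

lemma exists_bound_cutoff : ∃ D : ℝ, 1 ≤ D ∧ ∀ s, 0 ≤ s → s ≤ 1 →
    |deriv cutoff s| ≤ D ∧ |deriv (deriv cutoff) s| ≤ D := by
  obtain ⟨B, hB⟩ := (isCompact_Icc (a := (0 : ℝ)) (b := 1)).exists_bound_of_continuousOn
    contDiff_deriv_cutoff.continuous.continuousOn
  obtain ⟨B', hB'⟩ := (isCompact_Icc (a := (0 : ℝ)) (b := 1)).exists_bound_of_continuousOn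
    (contDiff_deriv_cutoff.continuous_deriv (by simp)).continuousOn
  refine ⟨1 + |B| + |B'|, by linarith [abs_nonneg B, abs_nonneg B'], fun s h0 h1 => ⟨?_, ?_⟩⟩
  · linarith [hB s ⟨h0, h1⟩, le_abs_self B, abs_nonneg B', Real.norm_eq_abs (deriv cutoff s)]
  · linarith [hB' s ⟨h0, h1⟩, le_abs_self B', abs_nonneg B,
      Real.norm_eq_abs (deriv (deriv cutoff) s)]

lemma HasTwoDerivs.mul {f f' f'' g g' g'' : ℝ → ℝ} (hf : HasTwoDerivs f f' f'')
    (hg : HasTwoDerivs g g' g'') : HasTwoDerivs (fun a => f a * g a)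
      (fun a => f' a * g a + f a * g' a) (fun a => f'' a * g a + 2 * f' a * g' a + f a * g'' a) :=
  fun a ha => ⟨(hf a ha).1.mul (hg a ha).1,
    (((hf a ha).2.mul (hg a ha).1).add ((hf a ha).1.mul (hg a ha).2)).congr_deriv (by ring)⟩

lemma HasTwoDerivs.const_mul {f f' f'' : ℝ → ℝ} (c : ℝ) (hf : HasTwoDerivs f f' f'') :
    HasTwoDerivs (fun a => c * f a) (fun a => c * f' a) (fun a => c * f'' a) :=
  fun a ha => ⟨(hf a ha).1.const_mul c, (hf a ha).2.const_mul c⟩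

lemma hasTwoDerivs_cutoff_sub (j : ℝ) : HasTwoDerivs (fun t => cutoff (t - j))
    (fun t => deriv cutoff (t - j)) (fun t => deriv (deriv cutoff) (t - j)) := fun a _ =>
  ⟨(hasDerivAt_cutoff (a - j)).comp_sub_const a j,
    (hasDerivAt_deriv_cutoff (a - j)).comp_sub_const a j⟩

lemma hasTwoDerivs_cutoff_const_sub (j : ℝ) : HasTwoDerivs (fun t => cutoff (j - t))
    (fun t => -deriv cutoff (j - t)) (fun t => deriv (deriv cutoff) (j - t)) := fun a _ =>
  ⟨(hasDerivAt_cutoff (j - a)).comp_const_sub j a,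
    ((hasDerivAt_deriv_cutoff (j - a)).comp_const_sub j a).neg.congr_deriv (neg_neg _)⟩

/-- The constant `(n² - m²) / (2 A)` of the block with the number `j`. -/
noncomputable def blockConst (A N j : ℝ) : ℝ := N ^ 2 * (16 * j ^ 3 - 128 * j ^ 2) / A

/-- The amplitude of the angular modulation in the block with the number `j`. -/
noncomputable def blockAmp (j : ℝ) : ℝ := (18 * j + 1) / (2 * j ^ 2 + 2 * j + 1)

/-- The logarithm of the quotient of the two waves in the block with the number `j`. -/
noncomputable def blockLog (A N j t : ℝ) : ℝ :=
  blockConst A N j * (1 / (j + 1 / 2) ^ 2 - 1 / t ^ 2)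

lemma hasTwoDerivs_blockLog (A N j : ℝ) : HasTwoDerivs (blockLog A N j)
    (fun t => 2 * blockConst A N j / t ^ 3) (fun t => -6 * blockConst A N j / t ^ 4) := by
  intro t ht
  have ht0 := ht.ne'
  have h := fun n : ℕ => hasDerivAt_pow (𝕜 := ℝ) n t
  constructor
  · have := ((((h 2).inv (pow_ne_zero 2 ht0)).const_sub
      (1 / (j + 1 / 2) ^ 2)).const_mul (blockConst A N j))
    unfold blockLog
    simp_rw [one_div] at *
    refine this.congr_deriv ?_
    push_cast
    field_simp
  · have := ((h 3).inv (pow_ne_zero 3 ht0)).const_mul (2 * blockConst A N j)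
    simp_rw [div_eq_mul_inv]
    refine this.congr_deriv ?_
    push_cast
    field_simp
    ring

section Bounds

variable {A N j t : ℝ}

lemma blockConst_nonneg (hA : 1 ≤ A) (hj : 32 ≤ j) : 0 ≤ blockConst A N j := by
  unfold blockConst
  have : 0 ≤ 16 * j ^ 3 - 128 * j ^ 2 := by nlinarith [sq_nonneg j]
  positivity

lemma blockConst_le (hA : 1 ≤ A) (hj : 32 ≤ j) : blockConst A N j ≤ 16 * N ^ 2 * j ^ 3 := by
  unfold blockConst
  rw [div_le_iff₀ (by linarith)]
  have h1 : 0 ≤ N ^ 2 * j ^ 3 := by positivity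
  nlinarith [mul_le_mul_of_nonneg_left hA h1, mul_nonneg (sq_nonneg N) (sq_nonneg j)]

lemma le_blockConst (hA : 1 ≤ A) (hAN : A ≤ N) (hj : 32 ≤ j) : 12 * j ^ 3 ≤ blockConst A N j := by
  unfold blockConst
  rw [le_div_iff₀ (by linarith)]
  have h1 : A ≤ N ^ 2 := by nlinarith
  have h2 : 12 * j ^ 3 ≤ 16 * j ^ 3 - 128 * j ^ 2 := by nlinarith [sq_nonneg j]
  have h3 : 0 ≤ 12 * j ^ 3 := by positivity
  nlinarith [mul_le_mul h2 h1 (by linarith) (h3.trans h2)]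

lemma blockLog_eq (hj : 32 ≤ j) (ht : 0 < t) : blockLog A N j t =
    blockConst A N j * (t ^ 2 - (j + 1 / 2) ^ 2) / ((j + 1 / 2) ^ 2 * t ^ 2) := by
  unfold blockLog
  have : j + 1 / 2 ≠ 0 := by linarith
  field_simp

/-- A constant of order `j³` meets the difference `t² - (j + 1/2)²` of order `j` over a denominator
of order `j⁴`. So the two waves stay comparable, uniformly in `j`. -/
lemma abs_blockLog_le (hA : 1 ≤ A) (hj : 32 ≤ j) (h1 : j ≤ t) (h2 : t ≤ j + 1) :
    |blockLog A N j t| ≤ 32 * N ^ 2 := by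
  have ht : 0 < t := by linarith
  have hj0 : 0 < j := by linarith
  rw [blockLog_eq hj ht, abs_div, abs_mul, abs_of_nonneg (blockConst_nonneg hA hj),
    abs_of_pos (a := (j + 1 / 2) ^ 2 * t ^ 2) (by positivity), div_le_iff₀ (by positivity)]
  have e1 : |t ^ 2 - (j + 1 / 2) ^ 2| ≤ 2 * j := by
    rw [abs_le]; constructor <;> nlinarith
  have e2 : j ^ 2 * j ^ 2 ≤ (j + 1 / 2) ^ 2 * t ^ 2 := by gcongr; linarith
  calc blockConst A N j * |t ^ 2 - (j + 1 / 2) ^ 2| ≤ 16 * N ^ 2 * j ^ 3 * (2 * j) :=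
        mul_le_mul (blockConst_le hA hj) e1 (abs_nonneg _) (by positivity)
    _ = 32 * N ^ 2 * (j ^ 2 * j ^ 2) := by ring
    _ ≤ _ := by gcongr

lemma abs_deriv_blockLog_le (hA : 1 ≤ A) (hj : 32 ≤ j) (h1 : j ≤ t) :
    |2 * blockConst A N j / t ^ 3| ≤ 32 * N ^ 2 := by
  have ht : 0 < t := by linarith
  have hj0 : 0 < j := by linarith
  have hc := blockConst_nonneg (N := N) hA hj
  rw [abs_of_nonneg (by positivity), div_le_iff₀ (by positivity)]
  have : 16 * N ^ 2 * j ^ 3 ≤ 16 * N ^ 2 * t ^ 3 := by gcongr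
  linarith [blockConst_le (N := N) hA hj]

lemma abs_deriv2_blockLog_le (hA : 1 ≤ A) (hj : 32 ≤ j) (h1 : j ≤ t) :
    |-6 * blockConst A N j / t ^ 4| ≤ 96 * N ^ 2 := by
  have ht : 1 ≤ t := by linarith
  have hj0 : 0 < j := by linarith
  have hc := blockConst_nonneg (N := N) hA hj
  rw [abs_div, abs_mul, abs_neg, abs_of_nonneg hc, abs_of_nonneg (a := t ^ 4) (by positivity),
    div_le_iff₀ (by positivity)]
  have e : j ^ 3 ≤ t ^ 4 :=
    (pow_le_pow_left₀ hj0.le h1 3).trans (pow_le_pow_right₀ ht (by norm_num))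
  have : 16 * N ^ 2 * j ^ 3 ≤ 16 * N ^ 2 * t ^ 4 := by gcongr
  norm_num
  linarith [blockConst_le (N := N) hA hj]

/-- The waves carry `∓L/2` with `L = blockLog A N j t`, and here the cutoff may suppress the half
belonging to the first wave. The other half alone must give the factor `2`, whence `2 log 2`. -/
lemma blockLog_le_neg (hA : 1 ≤ A) (hAN : A ≤ N) (hj : 32 ≤ j) (h1 : j ≤ t) (h2 : t ≤ j + 1 / 3) :
    blockLog A N j t ≤ -(2 * Real.log 2) := by
  have ht : 0 < t := by linarith
  have hj0 : 0 < j := by linarith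
  have hlog : 2 * Real.log 2 ≤ 3 / 2 := by linarith [Real.log_two_lt_d9]
  refine le_trans ?_ (neg_le_neg hlog)
  rw [blockLog_eq hj ht, div_le_iff₀ (by positivity)]
  have e1 : j / 3 ≤ (j + 1 / 2) ^ 2 - t ^ 2 := by nlinarith
  have e2 := mul_le_mul (le_blockConst hA hAN hj) e1 (by positivity) (blockConst_nonneg hA hj)
  have e3 : (j + 1 / 2) ^ 2 * t ^ 2 ≤ (33 / 32 * j) ^ 2 * (33 / 32 * j) ^ 2 := by
    gcongr <;> linarith
  have e4 : 0 ≤ j ^ 4 := by positivity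
  nlinarith

lemma le_blockLog (hA : 1 ≤ A) (hAN : A ≤ N) (hj : 32 ≤ j) (h1 : j + 2 / 3 ≤ t) (h2 : t ≤ j + 1) :
    2 * Real.log 2 ≤ blockLog A N j t := by
  have ht : 0 < t := by linarith
  have hj0 : 0 < j := by linarith
  have hlog : 2 * Real.log 2 ≤ 3 / 2 := by linarith [Real.log_two_lt_d9]
  refine hlog.trans ?_
  rw [blockLog_eq hj ht, le_div_iff₀ (by positivity)]
  have e1 : j / 3 ≤ t ^ 2 - (j + 1 / 2) ^ 2 := by nlinarith
  have e2 := mul_le_mul (le_blockConst hA hAN hj) e1 (by positivity) (blockConst_nonneg hA hj)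
  have e3 : (j + 1 / 2) ^ 2 * t ^ 2 ≤ (33 / 32 * j) ^ 2 * (33 / 32 * j) ^ 2 := by
    gcongr <;> linarith
  have e4 : 0 ≤ j ^ 4 := by positivity
  nlinarith

lemma blockAmp_nonneg (hj : 32 ≤ j) : 0 ≤ blockAmp j := by
  unfold blockAmp
  positivity

lemma blockAmp_le_half (hj : 32 ≤ j) : blockAmp j ≤ 1 / 2 := by
  unfold blockAmp
  rw [div_le_iff₀ (by positivity)]
  nlinarith

/-- The denominator of the amplitude is the sum of the frequencies divided by `N`. Hence the local
frequency at `τ ≡ π` is `N(j + 1)² - N(18j + 1) = N(j² - 16j)`, which lies below `Nj²`. -/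
lemma blockAmp_mul (hj : 32 ≤ j) :
    blockAmp j * (N * j ^ 2 + N * (j + 1) ^ 2) = N * (18 * j + 1) := by
  unfold blockAmp
  have : 2 * j ^ 2 + 2 * j + 1 ≠ 0 := by positivity
  field_simp
  ring

end Bounds

/-! ### Inequalities for two interfering waves -/

/-- A lower bound for the sum of two waves with reciprocal amplitudes. -/
lemma abs_cos_le_norm_exp_add_exp {δ τ ε x y : ℝ} (h0 : 0 ≤ ε) (h1 : ε ≤ 1 / 2)
    (hxy : x + y = τ + ε * Real.sin τ) :
    |Real.cos (τ / 2)| ≤ ‖Complex.exp (-(δ / 2 : ℝ) + Complex.I * x) +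
      Complex.exp ((δ / 2 : ℝ) - Complex.I * y)‖ := by
  -- Taking out the mean phase leaves a hyperbolic cosine, whose real part is `cosh(δ/2) cos((x +
  -- y)/2)`; the ratio of the waves can only help.
  have e1 : Complex.exp (-(δ / 2 : ℝ) + Complex.I * x) + Complex.exp ((δ / 2 : ℝ) - Complex.I * y) =
      Complex.exp (((x - y) / 2 : ℝ) * Complex.I) *
        (2 * Complex.cosh ((δ / 2 : ℝ) + (-((x + y) / 2) : ℝ) * Complex.I)) := by
    rw [Complex.two_cosh, mul_add, ← Complex.exp_add, ← Complex.exp_add, add_comm]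
    congr 2 <;> (push_cast; ring)
  have e2 : (Complex.cosh ((δ / 2 : ℝ) + (-((x + y) / 2) : ℝ) * Complex.I)).re =
      Real.cosh (δ / 2) * Real.cos ((x + y) / 2) := by
    rw [Complex.cosh_add, Complex.cosh_mul_I, Complex.sinh_mul_I, ← Complex.ofReal_cosh,
      ← Complex.ofReal_cos, ← Complex.ofReal_sinh, ← Complex.ofReal_sin, ← Complex.ofReal_mul,
      ← mul_assoc, ← Complex.ofReal_mul, Complex.add_re, Complex.ofReal_re,
      Complex.re_ofReal_mul, Complex.I_re, mul_zero, add_zero, Real.cos_neg]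
  have e3 : |Real.cos ((x + y) / 2)| ≤
      ‖Complex.cosh ((δ / 2 : ℝ) + (-((x + y) / 2) : ℝ) * Complex.I)‖ := by
    refine le_trans ?_ (Complex.abs_re_le_norm _)
    rw [e2, abs_mul, abs_of_pos (Real.cosh_pos _)]
    nlinarith [Real.one_le_cosh (δ / 2), abs_nonneg (Real.cos ((x + y) / 2))]
  rw [e1, norm_mul, Complex.norm_exp_ofReal_mul_I, one_mul, norm_mul, Complex.norm_ofNat]
  -- The phase error `(ε/2) sin τ` contains the factor `cos(τ/2)`, so the modulation does not move
  -- the zeros of the cosine. With `ε ≤ 1/2` it costs at most half, which the factor `2` from `2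
  -- cosh` restores.
  have e4 : |Real.cos (τ / 2)| - |Real.cos ((x + y) / 2)| ≤ ε * |Real.cos (τ / 2)| := by
    have hs : Real.sin τ = 2 * Real.sin (τ / 2) * Real.cos (τ / 2) := by
      rw [← Real.sin_two_mul]; ring_nf
    have hl : |Real.cos (τ / 2) - Real.cos ((x + y) / 2)| ≤ |τ / 2 - (x + y) / 2| := by
      simpa [Real.dist_eq] using Real.abs_cos_sub_cos_le (τ / 2) ((x + y) / 2)
    have hd : τ / 2 - (x + y) / 2 = -(ε * Real.sin (τ / 2) * Real.cos (τ / 2)) := by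
      rw [hxy, hs]; ring
    rw [hd, abs_neg, abs_mul, abs_mul, abs_of_nonneg h0] at hl
    have := Real.abs_sin_le_one (τ / 2)
    have h3 : ε * |Real.sin (τ / 2)| * |Real.cos (τ / 2)| ≤ ε * 1 * |Real.cos (τ / 2)| := by gcongr
    have := abs_sub_abs_le_abs_sub (Real.cos (τ / 2)) (Real.cos ((x + y) / 2))
    linarith
  have e5 : ε * |Real.cos (τ / 2)| ≤ 1 / 2 * |Real.cos (τ / 2)| := by gcongr
  linarith

/-- At `τ ≡ π` both `sin τ` and `1 + cos τ` vanish, and each is at most `2|cos(τ/2)|`. After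
subtraction of the frequency term at that angle, every remaining term contains one of them. -/
lemma norm_angular_sub_le {N t q M a τ : ℝ} (hN : 0 ≤ N) (ht : 1 ≤ t) (hq0 : 0 ≤ q)
    (hq : q ≤ 19 * N * t) (hM0 : 0 ≤ M) (hqM : q * M ≤ 57 * N ^ 2 * t ^ 3) (ha0 : 0 ≤ a)
    (ha : a ≤ 3 / 2 * N * t ^ 2) :
    ‖Complex.I * (q * M * Real.sin τ : ℝ) + (-Complex.I * (a + q * Real.cos τ : ℝ)) ^ 2 +
      ((a - q) ^ 2 : ℝ)‖ ≤ 1700 * N ^ 2 * t ^ 3 * |Real.cos (τ / 2)| := by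
  have hc1 := Real.abs_cos_le_one (τ / 2)
  have hs : |Real.sin τ| ≤ 2 * |Real.cos (τ / 2)| := by
    have : Real.sin τ = 2 * Real.sin (τ / 2) * Real.cos (τ / 2) := by
      rw [← Real.sin_two_mul]; ring_nf
    rw [this, abs_mul, abs_mul, abs_two]
    have := Real.abs_sin_le_one (τ / 2)
    nlinarith [abs_nonneg (Real.cos (τ / 2))]
  have hc : |1 + Real.cos τ| ≤ 2 * |Real.cos (τ / 2)| := by
    have : 1 + Real.cos τ = 2 * Real.cos (τ / 2) ^ 2 := by
      rw [Real.cos_sq]; ring_nf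
    rw [this, abs_mul, abs_two, abs_pow]
    nlinarith [abs_nonneg (Real.cos (τ / 2))]
  have e : Complex.I * (q * M * Real.sin τ : ℝ) + (-Complex.I * (a + q * Real.cos τ : ℝ)) ^ 2 +
      ((a - q) ^ 2 : ℝ) = Complex.I * (q * M * Real.sin τ : ℝ) -
        (q * (1 + Real.cos τ) * (2 * a - q * (1 - Real.cos τ)) : ℝ) := by
    push_cast
    linear_combination ((a : ℂ) + q * Complex.cos τ) ^ 2 * Complex.I_sq
  rw [e]
  refine (norm_sub_le _ _).trans ?_
  rw [norm_mul, Complex.norm_I, one_mul, Complex.norm_real, Complex.norm_real, Real.norm_eq_abs,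
    Real.norm_eq_abs, abs_mul (q * M), abs_mul _ (2 * a - _), abs_mul q (1 + _),
    abs_of_nonneg hq0, abs_of_nonneg (mul_nonneg hq0 hM0)]
  have h2 : |2 * a - q * (1 - Real.cos τ)| ≤ 41 * N * t ^ 2 := by
    have h3 := Real.cos_le_one τ
    have h4 := Real.neg_one_le_cos τ
    have h5 : q * (1 - Real.cos τ) ≤ 2 * q := by nlinarith
    have h6 : 0 ≤ q * (1 - Real.cos τ) := by nlinarith
    have h7 : N * t ≤ N * t ^ 2 := mul_le_mul_of_nonneg_left (by nlinarith) hN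
    rw [abs_le]; constructor <;> nlinarith
  have h8 : q * M * |Real.sin τ| ≤ 57 * N ^ 2 * t ^ 3 * (2 * |Real.cos (τ / 2)|) := by
    gcongr
  have h9 : q * |1 + Real.cos τ| * |2 * a - q * (1 - Real.cos τ)| ≤
      19 * N * t * (2 * |Real.cos (τ / 2)|) * (41 * N * t ^ 2) := by
    gcongr
  have h10 : 0 ≤ N ^ 2 * t ^ 3 * |Real.cos (τ / 2)| := by positivity
  nlinarith

/-- A difference of squares: `g - Nt²` is `O(t)` and `g + Nt²` is `O(t²)`, so their product loses
one power of `t` against `t⁴`, and `h` has the same order. -/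
lemma norm_sq_add_angular_le {N t g h : ℝ} (hN : 0 ≤ N) (ht : 1 ≤ t)
    (hg : |g - N * t ^ 2| ≤ 21 * N * t) (hh : |h| ≤ 57 * N ^ 2 * t ^ 3) :
    ‖(N : ℂ) ^ 2 + (Complex.I * h - (g : ℂ) ^ 2) / t ^ 4‖ ≤ 540 * N ^ 2 / t := by
  have ht0 : 0 < t := by linarith
  have htc : (t : ℂ) ≠ 0 := by exact_mod_cast ht0.ne'
  have htn : ‖(t : ℂ)‖ = t := by rw [Complex.norm_real, Real.norm_of_nonneg ht0.le]
  have e : (N : ℂ) ^ 2 + (Complex.I * h - (g : ℂ) ^ 2) / t ^ 4 =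
      (Complex.I * h - ((g - N * t ^ 2) * (g + N * t ^ 2) : ℝ)) / t ^ 4 := by
    field_simp; push_cast; ring
  rw [e, norm_div, norm_pow, htn, div_le_div_iff₀ (by positivity) ht0]
  have h1 : ‖Complex.I * h - ((g - N * t ^ 2) * (g + N * t ^ 2) : ℝ)‖ ≤ 540 * N ^ 2 * t ^ 3 := by
    refine (norm_sub_le _ _).trans ?_
    rw [norm_mul, Complex.norm_I, one_mul, Complex.norm_real, Complex.norm_real, Real.norm_eq_abs,
      Real.norm_eq_abs, abs_mul]
    have h2 : |g + N * t ^ 2| ≤ 23 * N * t ^ 2 := by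
      have h7 : N * t ≤ N * t ^ 2 := mul_le_mul_of_nonneg_left (by nlinarith) hN
      have h8 : 0 ≤ N * t ^ 2 := by positivity
      obtain ⟨h9, h10⟩ := abs_le.1 hg
      rw [abs_le]; constructor <;> linarith
    have h3 := mul_le_mul hg h2 (abs_nonneg _) (by positivity)
    nlinarith
  calc _ ≤ 540 * N ^ 2 * t ^ 3 * t := by gcongr
    _ = _ := by ring

/-- Lower bound for the gradient of a sum of two waves. -/
lemma le_six_mul_of_wave_bounds {w t K A N G : ℝ} {a₁ a₂ e₁ e₂ X f₁ f₂ : ℂ} (hw : 0 ≤ w)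
    (hK : 1 ≤ K) (ht : 6 * K + 3 ≤ t) (hA : 1 ≤ A) (hAN : A ≤ N)
    (ha₁ : ‖a₁‖ ≤ 1) (ha₂ : ‖a₂‖ ≤ 1)
    (hdom : 2 / 3 * (‖e₁‖ + ‖e₂‖) ≤ ‖a₁ * e₁‖ + ‖a₂ * e₂‖)
    (hX : ‖X‖ ≤ 2 * K * (‖e₁‖ + ‖e₂‖)) (hf₁ : ‖f₁ - Complex.I * (N * t ^ 2)‖ ≤ K * t)
    (hf₂ : ‖f₂ + Complex.I * (N * t ^ 2)‖ ≤ K * t)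
    (h₁ : w * ‖X + (1 / t - 2 * A * t) * (a₁ * e₁ + a₂ * e₂)‖ ≤ 2 * t * G)
    (h₂ : w * ‖a₁ * f₁ * e₁ + a₂ * f₂ * e₂‖ ≤ t ^ 2 * G) :
    w * (‖e₁‖ + ‖e₂‖) ≤ 6 * G := by
  have ht1 : 1 ≤ t := by linarith
  have ht0 : 0 < t := by linarith
  have htn : ‖(t : ℂ)‖ = t := by rw [Complex.norm_real, Real.norm_of_nonneg ht0.le]
  set E := ‖e₁‖ + ‖e₂‖ with hE
  have hE0 : 0 ≤ E := by positivity
  have n₁ : ‖a₁ * e₁‖ ≤ ‖e₁‖ := by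
    rw [norm_mul]; nlinarith [norm_nonneg e₁]
  have n₂ : ‖a₂ * e₂‖ ≤ ‖e₂‖ := by
    rw [norm_mul]; nlinarith [norm_nonneg e₂]
  have hR : ‖a₁ * e₁ + a₂ * e₂‖ ≤ E := (norm_add_le _ _).trans (add_le_add n₁ n₂)
  -- the radial derivative
  have b₁ : 2 * t * ‖a₁ * e₁ + a₂ * e₂‖ - (2 * K + 1) * E ≤
      ‖X + (1 / t - 2 * A * t) * (a₁ * e₁ + a₂ * e₂)‖ := by
    set R := a₁ * e₁ + a₂ * e₂
    have e : 2 * A * t * R = (X + 1 / t * R) - (X + (1 / t - 2 * A * t) * R) := by ring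
    have h3 := congrArg norm e
    rw [norm_mul, norm_mul, norm_mul, Complex.norm_ofNat, htn, Complex.norm_real,
      Real.norm_of_nonneg (by linarith)] at h3
    have h4 : ‖X + 1 / t * R‖ ≤ 2 * K * E + 1 * E := by
      refine (norm_add_le _ _).trans (add_le_add hX ?_)
      rw [norm_mul, norm_div, norm_one, htn]
      gcongr
      exact (div_le_one ht0).2 ht1
    have h5 := norm_sub_le (X + 1 / t * R) (X + (1 / t - 2 * A * t) * R)
    have h6 : 2 * t * ‖R‖ ≤ 2 * A * t * ‖R‖ := by
      have : 0 ≤ t * ‖R‖ := by positivity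
      nlinarith
    linarith
  -- the angular derivative
  have b₂ : t ^ 2 * ‖a₁ * e₁ - a₂ * e₂‖ - K * t * E ≤ ‖a₁ * f₁ * e₁ + a₂ * f₂ * e₂‖ := by
    have e : Complex.I * (N * t ^ 2) * (a₁ * e₁ - a₂ * e₂) = (a₁ * f₁ * e₁ + a₂ * f₂ * e₂) -
        ((f₁ - Complex.I * (N * t ^ 2)) * (a₁ * e₁) +
          (f₂ + Complex.I * (N * t ^ 2)) * (a₂ * e₂)) := by ring
    have h3 := congrArg norm e
    rw [norm_mul, norm_mul, norm_mul, Complex.norm_I, one_mul, norm_pow, htn, Complex.norm_real,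
      Real.norm_of_nonneg (by linarith)] at h3
    have h4 : ‖(f₁ - Complex.I * (N * t ^ 2)) * (a₁ * e₁) +
          (f₂ + Complex.I * (N * t ^ 2)) * (a₂ * e₂)‖ ≤ K * t * ‖e₁‖ + K * t * ‖e₂‖ := by
      refine (norm_add_le _ _).trans (add_le_add ?_ ?_)
      · rw [norm_mul]; gcongr
      · rw [norm_mul]; gcongr
    have h5 := norm_sub_le (a₁ * f₁ * e₁ + a₂ * f₂ * e₂)
      ((f₁ - Complex.I * (N * t ^ 2)) * (a₁ * e₁) + (f₂ + Complex.I * (N * t ^ 2)) * (a₂ * e₂))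
    have h6 : t ^ 2 * ‖a₁ * e₁ - a₂ * e₂‖ ≤ N * t ^ 2 * ‖a₁ * e₁ - a₂ * e₂‖ := by
      have : 0 ≤ t ^ 2 * ‖a₁ * e₁ - a₂ * e₂‖ := by positivity
      nlinarith
    have h7 : K * t * E = K * t * ‖e₁‖ + K * t * ‖e₂‖ := by rw [hE]; ring
    linarith
  have hKt : (2 * K + 1) * E ≤ 1 / 3 * t * E := by gcongr; linarith
  have c₁ : w * (‖a₁ * e₁ + a₂ * e₂‖ - 1 / 6 * E) ≤ G := by
    refine le_of_mul_le_mul_left (a := 2 * t) (le_trans ?_ h₁) (by positivity)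
    rw [← mul_assoc, mul_comm (2 * t) w, mul_assoc]
    refine mul_le_mul_of_nonneg_left ?_ hw
    linarith
  have c₂ : w * (‖a₁ * e₁ - a₂ * e₂‖ - 1 / 6 * E) ≤ G := by
    refine le_of_mul_le_mul_left (a := t ^ 2) (le_trans ?_ h₂) (by positivity)
    rw [← mul_assoc, mul_comm (t ^ 2) w, mul_assoc]
    refine mul_le_mul_of_nonneg_left ?_ hw
    have h8 : K * t * E ≤ 1 / 6 * t * t * E := by
      have : 0 ≤ t * E := by positivity
      nlinarith
    linarith
  have p : ‖a₁ * e₁‖ + ‖a₂ * e₂‖ ≤ ‖a₁ * e₁ + a₂ * e₂‖ + ‖a₁ * e₁ - a₂ * e₂‖ := by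
    have q₁ := norm_add_le (a₁ * e₁ + a₂ * e₂) (a₁ * e₁ - a₂ * e₂)
    have q₂ := norm_sub_le (a₁ * e₁ + a₂ * e₂) (a₁ * e₁ - a₂ * e₂)
    rw [show a₁ * e₁ + a₂ * e₂ + (a₁ * e₁ - a₂ * e₂) = 2 * (a₁ * e₁) by ring, norm_mul,
      Complex.norm_ofNat] at q₁
    rw [show a₁ * e₁ + a₂ * e₂ - (a₁ * e₁ - a₂ * e₂) = 2 * (a₂ * e₂) by ring, norm_mul,
      Complex.norm_ofNat] at q₂
    linarith
  -- The sum and the difference of the waves each lose `E/6`, so `2/3 - 1/3 = 1/3` of `E` survives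
  -- against `2G`; this is the constant `6`.
  have := mul_le_mul_of_nonneg_left (hdom.trans p) hw
  nlinarith

/-! ### The block and its uniform estimates -/

/-- The building block on the annulus `j ≤ √|x| ≤ j + 1`: it turns the wave with angular frequency
`σ N j²` into the one with angular frequency `-σ N (j + 1)²`. -/
noncomputable def block (A : ℝ) (N j : ℕ) (σ : ℝ) : Plane → ℂ :=
  twoWave A σ (N * j ^ 2) (N * (j + 1) ^ 2) (fun t => cutoff (t - j))
    (fun t => -(1 / 2) * (cutoff (j + 1 - t) * blockLog A N j t)) (fun t => cutoff (j + 1 - t))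
    (fun t => 1 / 2 * (cutoff (t - j) * blockLog A N j t)) (fun t => blockAmp j * cutoff (t - j))

lemma contDiffAt_block (A : ℝ) (N j : ℕ) (σ : ℝ) {x : Plane} (hx : x ≠ 0) :
    ContDiffAt ℝ 2 (block A N j σ) x := by
  have h1 : ContDiffOn ℝ 2 (fun t => cutoff (t - j)) (Set.Ioi 0) :=
    (contDiff_cutoff.comp (contDiff_id.sub contDiff_const)).contDiffOn
  have h2 : ContDiffOn ℝ 2 (fun t => cutoff (j + 1 - t)) (Set.Ioi 0) :=
    (contDiff_cutoff.comp (contDiff_const.sub contDiff_id)).contDiffOn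
  have h3 : ContDiffOn ℝ 2 (blockLog A N j) (Set.Ioi 0) := by
    unfold blockLog
    refine contDiffOn_const.mul (contDiffOn_const.sub (contDiffOn_const.div
      (contDiffOn_id.pow 2) fun t ht => pow_ne_zero 2 ?_))
    exact ne_of_gt ht
  exact contDiffAt_twoWave _ _ _ _ h1 (contDiffOn_const.mul (h2.mul h3)) h2
    (contDiffOn_const.mul (h1.mul h3)) (contDiffOn_const.mul h1) hx

/-- The equation and the gradient for the block. -/
lemma block_formulas {A : ℝ} {l : ℂ} {N j : ℕ} {σ : ℝ} (hσ : σ = 1 ∨ σ = -1)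
    (hl : (A : ℂ) ^ 2 + l = N ^ 2) {t θ ϑ : ℝ} (ht : 0 < t) (hϑ : ϑ = σ * θ)
    {s₁ d₁ c₁ s₂ d₂ c₂ L L' L'' S C M : ℝ}
    (hs₁ : s₁ = cutoff (t - j)) (hd₁ : d₁ = deriv cutoff (t - j))
    (hc₁ : c₁ = deriv (deriv cutoff) (t - j)) (hs₂ : s₂ = cutoff (j + 1 - t))
    (hd₂ : d₂ = -deriv cutoff (j + 1 - t)) (hc₂ : c₂ = deriv (deriv cutoff) (j + 1 - t))
    (hL : L = blockLog A N j t) (hL' : L' = 2 * blockConst A N j / t ^ 3)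
    (hL'' : L'' = -6 * blockConst A N j / t ^ 4)
    (hM : M = ((N * j ^ 2 + N * (j + 1) ^ 2 : ℕ) : ℝ))
    (hS : S = Real.sin (M * ϑ)) (hC : C = Real.cos (M * ϑ))
    {Ψ₁ Ψ₂ p₁ p₂ p₁' p₂' f₁ f₂ f₂' : ℂ}
    (hΨ₁ : Ψ₁ = (-(1 / 2) * (s₂ * L) : ℝ) + Complex.I * ((N * j ^ 2 * ϑ : ℝ) : ℂ))
    (hΨ₂ : Ψ₂ = (1 / 2 * (s₁ * L) : ℝ) -
      Complex.I * ((N * (j + 1) ^ 2 * ϑ + blockAmp j * s₁ * S : ℝ) : ℂ))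
    (hp₁ : p₁ = (-(1 / 2) * (d₂ * L + s₂ * L') : ℝ))
    (hp₂ : p₂ = (1 / 2 * (d₁ * L + s₁ * L') : ℝ) - Complex.I * (blockAmp j * d₁ * S : ℝ))
    (hp₁' : p₁' = (-(1 / 2) * (c₂ * L + 2 * d₂ * L' + s₂ * L'') : ℝ))
    (hp₂' : p₂' = (1 / 2 * (c₁ * L + 2 * d₁ * L' + s₁ * L'') : ℝ) -
      Complex.I * (blockAmp j * c₁ * S : ℝ))
    (hf₁ : f₁ = Complex.I * (N * j ^ 2 : ℝ))
    (hf₂ : f₂ = -Complex.I * (N * (j + 1) ^ 2 + blockAmp j * s₁ * M * C : ℝ))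
    (hf₂' : f₂' = Complex.I * (blockAmp j * s₁ * M ^ 2 * S : ℝ)) :
    (Δ (block A N j σ)) (polar (t ^ 2) θ) + l * block A N j σ (polar (t ^ 2) θ) = weight A t *
      (Complex.exp Ψ₁ * waveCoeff A t s₁ d₁ c₁ p₁ p₁' (N ^ 2 + f₁ ^ 2 / t ^ 4) +
        Complex.exp Ψ₂ * waveCoeff A t s₂ d₂ c₂ p₂ p₂' (N ^ 2 + (f₂' + f₂ ^ 2) / t ^ 4)) ∧
    ‖weight A t * ((d₁ + s₁ * p₁) * Complex.exp Ψ₁ + (d₂ + s₂ * p₂) * Complex.exp Ψ₂ +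
        (1 / t - 2 * A * t) * (s₁ * Complex.exp Ψ₁ + s₂ * Complex.exp Ψ₂))‖ ≤
      2 * t * ‖fderiv ℝ (block A N j σ) (polar (t ^ 2) θ)‖ ∧
    ‖weight A t * (s₁ * f₁ * Complex.exp Ψ₁ + s₂ * f₂ * Complex.exp Ψ₂)‖ ≤
      t ^ 2 * ‖fderiv ℝ (block A N j σ) (polar (t ^ 2) θ)‖ ∧
    block A N j σ (polar (t ^ 2) θ) =
      weight A t * (s₁ * Complex.exp Ψ₁ + s₂ * Complex.exp Ψ₂) := by
  have hx : polar (t ^ 2) θ ≠ 0 := norm_pos_iff.1 (by rw [norm_polar (sq_nonneg t)]; positivity)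
  have h1 := hasTwoDerivs_cutoff_sub (j : ℝ)
  have h2 := hasTwoDerivs_cutoff_const_sub ((j : ℝ) + 1)
  have h3 := hasTwoDerivs_blockLog A N j
  have e₁ : Ψ₁ = ((-(1 / 2) * (cutoff (j + 1 - t) * blockLog A N j t) : ℝ) : ℂ) +
      Complex.I * ((N * j ^ 2 : ℕ) * ϑ) := by
    rw [hΨ₁, hs₂, hL]; push_cast; ring
  have e₂ : Ψ₂ = ((1 / 2 * (cutoff (t - j) * blockLog A N j t) : ℝ) : ℂ) +
      secondPhase (N * j ^ 2) (N * (j + 1) ^ 2) (blockAmp j * cutoff (t - j)) ϑ := by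
    rw [hΨ₂, hs₁, hL, secondPhase, hS, hM]; push_cast; ring
  have e₃ := twoWave_polar A hσ (N * j ^ 2) (N * (j + 1) ^ 2) (fun t => cutoff (t - j))
    (fun t => -(1 / 2) * (cutoff (j + 1 - t) * blockLog A N j t)) (fun t => cutoff (j + 1 - t))
    (fun t => 1 / 2 * (cutoff (t - j) * blockLog A N j t)) (fun t => blockAmp j * cutoff (t - j))
    ht θ
  obtain ⟨k1, k2, k3⟩ := twoWave_formulas (A := A) (l := l) hσ (n := N * j ^ 2)
    (n' := N * (j + 1) ^ 2) h1 ((h2.mul h3).const_mul (-(1 / 2))) h2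
    ((h1.mul h3).const_mul (1 / 2)) (h1.const_mul (blockAmp j)) ht hϑ
    (contDiffAt_block A N j σ hx) e₁ e₂
    (p₁ := p₁) (p₂ := p₂) (p₁' := p₁') (p₂' := p₂') (f₁ := f₁) (f₂ := f₂) (f₂' := f₂')
    (by rw [hp₁, hd₂, hL, hs₂, hL'])
    (by rw [hp₂, hd₁, hL, hs₁, hL', hS, hM]; push_cast; ring)
    (by rw [hp₁', hc₂, hL, hd₂, hL', hs₂, hL''])
    (by rw [hp₂', hc₁, hL, hd₁, hL', hs₁, hL'', hS, hM]; push_cast; ring)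
    (by rw [hf₁]; push_cast; ring)
    (by rw [hf₂, hs₁, hC, hM]; push_cast; ring)
    (by rw [hf₂', hs₁, hS, hM]; push_cast; ring)
  rw [hl] at k1
  rw [← hϑ, ← e₂] at e₃
  have e₄ : ((-(1 / 2) * (cutoff (j + 1 - t) * blockLog A N j t) : ℝ) : ℂ) +
      Complex.I * ((N * j ^ 2 : ℕ) * (ϑ : ℂ)) = Ψ₁ := e₁.symm
  rw [e₄] at e₃
  subst hs₁ hd₁ hc₁ hs₂ hd₂ hc₂
  exact ⟨k1, k2, k3, e₃⟩

/-- The larger wave has full amplitude and the smaller one can cancel at most half of it, so no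
zeros occur where a cutoff varies. -/
lemma norm_waves_le_of_dominated {a₁ a₂ e₁ e₂ : ℂ} (ha₁ : ‖a₁‖ ≤ 1) (ha₂ : ‖a₂‖ ≤ 1)
    (h : a₁ = 1 ∧ 2 * ‖e₂‖ ≤ ‖e₁‖ ∨ a₂ = 1 ∧ 2 * ‖e₁‖ ≤ ‖e₂‖) :
    ‖e₁‖ + ‖e₂‖ ≤ 3 * ‖a₁ * e₁ + a₂ * e₂‖ ∧
      2 / 3 * (‖e₁‖ + ‖e₂‖) ≤ ‖a₁ * e₁‖ + ‖a₂ * e₂‖ := by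
  have n₁ : ‖a₁ * e₁‖ ≤ ‖e₁‖ := by rw [norm_mul]; nlinarith [norm_nonneg e₁]
  have n₂ : ‖a₂ * e₂‖ ≤ ‖e₂‖ := by rw [norm_mul]; nlinarith [norm_nonneg e₂]
  have m₁ := norm_sub_le (a₁ * e₁ + a₂ * e₂) (a₂ * e₂)
  have m₂ := norm_sub_le (a₁ * e₁ + a₂ * e₂) (a₁ * e₁)
  rw [add_sub_cancel_right] at m₁
  rw [add_sub_cancel_left] at m₂
  rcases h with ⟨rfl, h⟩ | ⟨rfl, h⟩
  · rw [one_mul] at *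
    constructor <;> linarith [norm_nonneg (a₂ * e₂)]
  · rw [one_mul] at *
    constructor <;> linarith [norm_nonneg (a₁ * e₁)]

lemma norm_exp_sub_I_mul (a y : ℝ) : ‖Complex.exp (a - Complex.I * y)‖ = Real.exp a := by
  rw [Complex.norm_exp]; simp

lemma norm_exp_add_I_mul (a y : ℝ) : ‖Complex.exp (a + Complex.I * y)‖ = Real.exp a := by
  rw [Complex.norm_exp]; simp

/-- Bounds for the coefficients of the logarithmic derivatives of the two waves. -/
lemma abs_half_mul_le {B D s d c L L' L'' : ℝ} (hB : 0 ≤ B) (hD : 1 ≤ D) (hs : |s| ≤ 1)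
    (hd : |d| ≤ D) (hc : |c| ≤ D) (hL : |L| ≤ 32 * B) (hL' : |L'| ≤ 32 * B)
    (hL'' : |L''| ≤ 96 * B) :
    |1 / 2 * (d * L + s * L')| ≤ 32 * (B * D) ∧
      |1 / 2 * (c * L + 2 * d * L' + s * L'')| ≤ 96 * (B * D) := by
  have hBD : B ≤ B * D := by nlinarith
  have h1 : |d * L| ≤ D * (32 * B) := by rw [abs_mul]; gcongr
  have h2 : |s * L'| ≤ 1 * (32 * B) := by rw [abs_mul]; gcongr
  have h3 : |c * L| ≤ D * (32 * B) := by rw [abs_mul]; gcongr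
  have h4 : |2 * d * L'| ≤ 2 * D * (32 * B) := by rw [abs_mul, abs_mul, abs_two]; gcongr
  have h5 : |s * L''| ≤ 1 * (96 * B) := by rw [abs_mul]; gcongr
  constructor
  · rw [abs_mul, abs_of_pos (by norm_num : (0 : ℝ) < 1 / 2)]
    linarith [abs_add_le (d * L) (s * L')]
  · rw [abs_mul, abs_of_pos (by norm_num : (0 : ℝ) < 1 / 2)]
    linarith [abs_add_le (c * L + 2 * d * L') (s * L''), abs_add_le (c * L) (2 * d * L')]

lemma norm_add_mul_le {a d p : ℂ} {K : ℝ} (ha : ‖a‖ ≤ 1) (hd : ‖d‖ ≤ K) (hp : ‖p‖ ≤ K) :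
    ‖d + a * p‖ ≤ 2 * K := by
  refine (norm_add_le _ _).trans ?_
  rw [norm_mul]
  linarith [mul_le_mul ha hp (norm_nonneg _) zero_le_one]

lemma norm_real_sub_I_mul_le {a b K K' : ℝ} (ha : |a| ≤ K) (hb : |b| ≤ K') :
    ‖(a : ℂ) - Complex.I * b‖ ≤ K + K' := by
  refine (norm_sub_le _ _).trans (add_le_add ?_ ?_)
  · rwa [Complex.norm_real]
  · rwa [norm_mul, Complex.norm_I, one_mul, Complex.norm_real]

section Parameters

variable {N J t : ℝ}

lemma blockAmp_mul_le (hN : 0 ≤ N) (hJ : 32 ≤ J) (h1 : J ≤ t) :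
    blockAmp J * (N * J ^ 2 + N * (J + 1) ^ 2) ≤ 19 * N * t := by
  rw [blockAmp_mul hJ]
  have := mul_le_mul_of_nonneg_left h1 hN
  nlinarith

lemma frequency_add_le (hN : 0 ≤ N) (hJ : 32 ≤ J) (h1 : J ≤ t) :
    N * J ^ 2 + N * (J + 1) ^ 2 ≤ 3 * N * t ^ 2 := by
  have h3 : J ^ 2 + (J + 1) ^ 2 ≤ 3 * t ^ 2 := by nlinarith
  nlinarith

lemma frequency_succ_le (hN : 0 ≤ N) (hJ : 32 ≤ J) (h1 : J ≤ t) :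
    N * (J + 1) ^ 2 ≤ 3 / 2 * N * t ^ 2 := by
  have h3 : (J + 1) ^ 2 ≤ 3 / 2 * t ^ 2 := by nlinarith
  nlinarith

/-- This fixes the size of the annuli: while `√r` runs through an interval of length one, `Nr` moves
by `O(√r)` only. -/
lemma abs_frequency_sub_le (hN : 0 ≤ N) (hJ : 32 ≤ J) (h1 : J ≤ t) (h2 : t ≤ J + 1) :
    |N * J ^ 2 - N * t ^ 2| ≤ 21 * N * t := by
  rw [← mul_sub, abs_mul, abs_of_nonneg hN, mul_comm (21 : ℝ), mul_assoc]
  refine mul_le_mul_of_nonneg_left ?_ hN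
  rw [abs_le]; constructor <;> nlinarith

lemma abs_frequency_succ_sub_le {y : ℝ} (hN : 0 ≤ N) (hJ : 32 ≤ J) (h1 : J ≤ t) (h2 : t ≤ J + 1)
    (hy : |y| ≤ N * (18 * J + 1)) : |N * (J + 1) ^ 2 + y - N * t ^ 2| ≤ 21 * N * t := by
  have h4 : |N * (J + 1) ^ 2 - N * t ^ 2| ≤ N * (2 * J + 1) := by
    rw [← mul_sub, abs_mul, abs_of_nonneg hN]
    refine mul_le_mul_of_nonneg_left ?_ hN
    rw [abs_le]; constructor <;> nlinarith
  have h5 := abs_add_le (N * (J + 1) ^ 2 - N * t ^ 2) y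
  rw [show N * (J + 1) ^ 2 + y - N * t ^ 2 = N * (J + 1) ^ 2 - N * t ^ 2 + y by ring]
  have h6 : N * (20 * J + 2) ≤ N * (21 * t) := mul_le_mul_of_nonneg_left (by linarith) hN
  linarith

end Parameters

/-- In the middle of a block the coefficients of the two waves differ by an angular term only. -/
lemma waveCoeff_sub_waveCoeff {A N J t L' L'' M τ : ℝ} {b f₁ f₂ f₂' : ℂ} (hA : 1 ≤ A) (ht : 0 < t)
    (hJ : 32 ≤ J) (hL' : L' = 2 * blockConst A N J / t ^ 3)
    (hL'' : L'' = -6 * blockConst A N J / t ^ 4) (hM : M = N * J ^ 2 + N * (J + 1) ^ 2)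
    (hf₁ : f₁ = Complex.I * (N * J ^ 2 : ℝ))
    (hf₂ : f₂ = -Complex.I * (N * (J + 1) ^ 2 + blockAmp J * M * Real.cos τ : ℝ))
    (hf₂' : f₂' = Complex.I * (blockAmp J * M * M * Real.sin τ : ℝ)) :
    waveCoeff A t 1 0 0 (1 / 2 * L' : ℝ) (1 / 2 * L'' : ℝ) (b + (f₂' + f₂ ^ 2) / t ^ 4) -
      waveCoeff A t 1 0 0 (-(1 / 2) * L' : ℝ) (-(1 / 2) * L'' : ℝ) (b + f₁ ^ 2 / t ^ 4) =
      (Complex.I * (blockAmp J * M * M * Real.sin τ : ℝ) +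
          (-Complex.I * (N * (J + 1) ^ 2 + blockAmp J * M * Real.cos τ : ℝ)) ^ 2 +
          ((N * (J + 1) ^ 2 - blockAmp J * M) ^ 2 : ℝ)) / t ^ 4 := by
  have htc : (t : ℂ) ≠ 0 := by exact_mod_cast ht.ne'
  have g₃ : f₁ ^ 2 = -((N * J ^ 2) ^ 2 : ℝ) := by
    rw [hf₁, mul_pow, Complex.I_sq]; push_cast; ring
  -- This identity determines `blockConst`: the relative radial drift `A L'/t` has to balance `(n² -
  -- m²)/t⁴`, with `m` the local frequency at `τ ≡ π`.
  have g₄ : 2 * A * blockConst A N J =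
      (N * J ^ 2) ^ 2 - (N * (J + 1) ^ 2 - blockAmp J * M) ^ 2 := by
    rw [hM, blockAmp_mul hJ, blockConst]
    have : A ≠ 0 := by linarith
    field_simp
    ring
  have g₅ : (2 * A * blockConst A N J : ℂ) =
      ((N * J ^ 2) ^ 2 : ℝ) - ((N * (J + 1) ^ 2 - blockAmp J * M) ^ 2 : ℝ) := by
    exact_mod_cast g₄
  rw [← hf₂, ← hf₂', waveCoeff, waveCoeff, hL', hL'', g₃]
  push_cast at g₅ ⊢
  field_simp
  linear_combination (-8 * (t : ℂ) ^ 4) * g₅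

set_option maxHeartbeats 2000000 in
/-- On the annulus of the block, `Δ + l` is bounded by `O(|x|^{-1/2})`, the block by its gradient,
and the block decays exponentially, uniformly in `j`. -/
lemma block_estimates {A : ℝ} {l : ℂ} {N : ℕ} (hA : 1 ≤ A) (hAN : A ≤ N)
    (hl : (A : ℂ) ^ 2 + l = N ^ 2) : ∃ (j₀ : ℕ) (C : ℝ), 32 ≤ j₀ ∧ 0 < C ∧
      ∀ j ≥ j₀, ∀ σ : ℝ, σ = 1 ∨ σ = -1 → ∀ x : Plane, (j : ℝ) ≤ √‖x‖ → √‖x‖ ≤ j + 1 →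
        ‖(Δ (block A N j σ)) x + l * block A N j σ x‖ ≤ C / √‖x‖ * ‖block A N j σ x‖ ∧
        ‖block A N j σ x‖ ≤ C * ‖fderiv ℝ (block A N j σ) x‖ ∧
        ‖block A N j σ x‖ ≤ C * (√‖x‖ * Real.exp (-A * √‖x‖ ^ 2)) := by
  obtain ⟨D, hD1, hD⟩ := exists_bound_cutoff
  have hN1 : (1 : ℝ) ≤ N := hA.trans hAN
  set B : ℝ := (N : ℝ) ^ 2 with hB
  have hB1 : 1 ≤ B := one_le_pow₀ hN1
  have hNB : (N : ℝ) ≤ B := by nlinarith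
  set K : ℝ := 1000 * (B * D) with hK
  have hBD : B ≤ B * D := by nlinarith
  have hDB : D ≤ B * D := by nlinarith
  have hK1 : 1 ≤ K := by linarith
  -- Bounds both exponentials, whose exponents are at most half of `|L| ≤ 32B`.
  set Q : ℝ := Real.exp (16 * B) with hQ
  have hQ1 : 1 ≤ Q := Real.one_le_exp (by linarith)
  -- The start is late enough for the gradient inequality and for the bounds on the parameters. In
  -- the constant, `24K²` serves the outer zones and, with `1700BQ`, the middle zone; `6` serves the
  -- gradient and `2Q` the decay.
  refine ⟨⌈6 * K + 3⌉₊ + 32, 24 * K ^ 2 + 1700 * B * Q + 6 + 2 * Q, by omega, by positivity,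
    fun j hj σ hσ x hx1 hx2 => ?_⟩
  obtain ⟨t, ht⟩ : ∃ t, t = √‖x‖ := ⟨_, rfl⟩
  rw [← ht] at hx1 hx2 ⊢
  obtain ⟨J, hJ⟩ : ∃ J : ℝ, J = j := ⟨_, rfl⟩
  have hj32 : 32 ≤ J := by
    rw [hJ]; exact_mod_cast le_trans (by omega) hj
  have hjK : 6 * K + 3 ≤ J := by
    rw [hJ]
    refine (Nat.le_ceil _).trans ?_
    exact_mod_cast le_trans (by omega) hj
  rw [← hJ] at hx1 hx2
  have ht1 : 1 ≤ t := by linarith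
  have ht0 : 0 < t := by linarith
  obtain ⟨θ, hθ⟩ := exists_polar x
  have ht2 : t ^ 2 = ‖x‖ := by rw [ht, Real.sq_sqrt (norm_nonneg x)]
  rw [← ht2] at hθ
  -- names for the data at `x`
  obtain ⟨s₁, hs₁⟩ : ∃ s, s = cutoff (t - j) := ⟨_, rfl⟩
  obtain ⟨d₁, hd₁⟩ : ∃ s, s = deriv cutoff (t - j) := ⟨_, rfl⟩
  obtain ⟨c₁, hc₁⟩ : ∃ s, s = deriv (deriv cutoff) (t - j) := ⟨_, rfl⟩
  obtain ⟨s₂, hs₂⟩ : ∃ s, s = cutoff (j + 1 - t) := ⟨_, rfl⟩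
  obtain ⟨d₂, hd₂⟩ : ∃ s, s = -deriv cutoff (j + 1 - t) := ⟨_, rfl⟩
  obtain ⟨c₂, hc₂⟩ : ∃ s, s = deriv (deriv cutoff) (j + 1 - t) := ⟨_, rfl⟩
  obtain ⟨L, hL⟩ : ∃ s, s = blockLog A N j t := ⟨_, rfl⟩
  obtain ⟨L', hL'⟩ : ∃ s, s = 2 * blockConst A N j / t ^ 3 := ⟨_, rfl⟩
  obtain ⟨L'', hL''⟩ : ∃ s, s = -6 * blockConst A N j / t ^ 4 := ⟨_, rfl⟩
  obtain ⟨M, hM⟩ : ∃ s : ℝ, s = ((N * j ^ 2 + N * (j + 1) ^ 2 : ℕ) : ℝ) := ⟨_, rfl⟩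
  obtain ⟨ϑ, hϑ⟩ : ∃ s, s = σ * θ := ⟨_, rfl⟩
  obtain ⟨S, hS⟩ : ∃ s, s = Real.sin (M * ϑ) := ⟨_, rfl⟩
  obtain ⟨C, hC⟩ : ∃ s, s = Real.cos (M * ϑ) := ⟨_, rfl⟩
  obtain ⟨Ψ₁, hΨ₁⟩ : ∃ s : ℂ, s = (-(1 / 2) * (s₂ * L) : ℝ) +
    Complex.I * ((N * j ^ 2 * ϑ : ℝ) : ℂ) := ⟨_, rfl⟩
  obtain ⟨Ψ₂, hΨ₂⟩ : ∃ s : ℂ, s = (1 / 2 * (s₁ * L) : ℝ) -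
      Complex.I * ((N * (j + 1) ^ 2 * ϑ + blockAmp j * s₁ * S : ℝ) : ℂ) := ⟨_, rfl⟩
  obtain ⟨p₁, hp₁⟩ : ∃ s : ℂ, s = (-(1 / 2) * (d₂ * L + s₂ * L') : ℝ) := ⟨_, rfl⟩
  obtain ⟨p₂, hp₂⟩ : ∃ s : ℂ, s = (1 / 2 * (d₁ * L + s₁ * L') : ℝ) -
    Complex.I * (blockAmp j * d₁ * S : ℝ) := ⟨_, rfl⟩
  obtain ⟨p₁', hp₁'⟩ : ∃ s : ℂ, s = (-(1 / 2) * (c₂ * L + 2 * d₂ * L' + s₂ * L'') : ℝ) :=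
    ⟨_, rfl⟩
  obtain ⟨p₂', hp₂'⟩ : ∃ s : ℂ, s = (1 / 2 * (c₁ * L + 2 * d₁ * L' + s₁ * L'') : ℝ) -
      Complex.I * (blockAmp j * c₁ * S : ℝ) := ⟨_, rfl⟩
  obtain ⟨f₁, hf₁⟩ : ∃ s : ℂ, s = Complex.I * (N * j ^ 2 : ℝ) := ⟨_, rfl⟩
  obtain ⟨f₂, hf₂⟩ : ∃ s : ℂ, s =
    -Complex.I * (N * (j + 1) ^ 2 + blockAmp j * s₁ * M * C : ℝ) := ⟨_, rfl⟩
  obtain ⟨f₂', hf₂'⟩ : ∃ s : ℂ, s = Complex.I * (blockAmp j * s₁ * M ^ 2 * S : ℝ) := ⟨_, rfl⟩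
  obtain ⟨k1, k2, k3, k4⟩ := block_formulas (A := A) hσ hl ht0 hϑ hs₁ hd₁ hc₁ hs₂ hd₂ hc₂ hL hL'
    hL'' hM hS hC hΨ₁ hΨ₂ hp₁ hp₂ hp₁' hp₂' hf₁ hf₂ hf₂'
  rw [← hθ] at k1 k2 k3 k4
  -- bounds for the data
  rw [← hJ] at hs₁ hd₁ hc₁ hs₂ hd₂ hc₂ hL hL' hL'' hΨ₁ hΨ₂ hp₂ hp₂' hf₁ hf₂ hf₂'
  have s₁0 : 0 ≤ s₁ := hs₁ ▸ cutoff_nonneg _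
  have s₁1 : s₁ ≤ 1 := hs₁ ▸ cutoff_le_one _
  have s₂0 : 0 ≤ s₂ := hs₂ ▸ cutoff_nonneg _
  have s₂1 : s₂ ≤ 1 := hs₂ ▸ cutoff_le_one _
  have as₁ : |s₁| ≤ 1 := by rwa [abs_of_nonneg s₁0]
  have as₂ : |s₂| ≤ 1 := by rwa [abs_of_nonneg s₂0]
  have ad₁ : |d₁| ≤ D := hd₁ ▸ (hD (t - J) (by linarith) (by linarith)).1
  have ac₁ : |c₁| ≤ D := hc₁ ▸ (hD (t - J) (by linarith) (by linarith)).2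
  have ad₂ : |d₂| ≤ D := by
    rw [hd₂, abs_neg]; exact (hD (J + 1 - t) (by linarith) (by linarith)).1
  have ac₂ : |c₂| ≤ D := hc₂ ▸ (hD (J + 1 - t) (by linarith) (by linarith)).2
  have aL : |L| ≤ 32 * B := hL ▸ abs_blockLog_le hA hj32 hx1 hx2
  have aL' : |L'| ≤ 32 * B := hL' ▸ abs_deriv_blockLog_le hA hj32 hx1
  have aL'' : |L''| ≤ 96 * B := hL'' ▸ abs_deriv2_blockLog_le hA hj32 hx1
  have aS : |S| ≤ 1 := hS ▸ Real.abs_sin_le_one _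
  have aC : |C| ≤ 1 := hC ▸ Real.abs_cos_le_one _
  set ε := blockAmp J with hε
  have ε0 : 0 ≤ ε := blockAmp_nonneg hj32
  have ε1 : ε ≤ 1 / 2 := blockAmp_le_half hj32
  have hMJ : M = N * J ^ 2 + N * (J + 1) ^ 2 := by rw [hM, hJ]; push_cast; ring
  have hM0 : 0 ≤ M := by rw [hMJ]; positivity
  have hεM : ε * M = N * (18 * J + 1) := by rw [hMJ]; exact blockAmp_mul hj32
  have hN0 : (0 : ℝ) ≤ N := by linarith
  have hεMt : ε * M ≤ 19 * N * t := by rw [hMJ]; exact blockAmp_mul_le hN0 hj32 hx1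
  have hM3 : M ≤ 3 * N * t ^ 2 := by rw [hMJ]; exact frequency_add_le hN0 hj32 hx1
  have hεMM : ε * M * M ≤ 57 * (N : ℝ) ^ 2 * t ^ 3 := by
    calc ε * M * M ≤ 19 * N * t * (3 * N * t ^ 2) := by gcongr
      _ = _ := by ring
  have hn' := frequency_succ_le hN0 hj32 hx1
  have hg₁ := abs_frequency_sub_le hN0 hj32 hx1 hx2
  have hg₂ : |(N : ℝ) * (J + 1) ^ 2 + ε * s₁ * M * C - N * t ^ 2| ≤ 21 * N * t := by
    refine abs_frequency_succ_sub_le hN0 hj32 hx1 hx2 ?_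
    rw [← hεM, abs_mul, abs_mul, abs_mul, abs_of_nonneg ε0, abs_of_nonneg hM0]
    calc ε * |s₁| * M * |C| ≤ ε * 1 * M * 1 := by gcongr
      _ = _ := by ring
  have hh₂ : |ε * s₁ * M ^ 2 * S| ≤ 57 * (N : ℝ) ^ 2 * t ^ 3 := by
    rw [abs_mul, abs_mul, abs_mul, abs_of_nonneg ε0, abs_of_nonneg (sq_nonneg M)]
    calc ε * |s₁| * M ^ 2 * |S| ≤ ε * 1 * M ^ 2 * 1 := by gcongr
      _ = ε * M * M := by ring
      _ ≤ _ := hεMM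
  have hb₁ : ‖(N : ℂ) ^ 2 + f₁ ^ 2 / t ^ 4‖ ≤ K / t := by
    have h := norm_sq_add_angular_le (N := N) (g := N * J ^ 2) (h := 0) (by linarith) ht1 hg₁
      (by rw [abs_zero]; positivity)
    have e : f₁ ^ 2 = Complex.I * (0 : ℝ) - ((N * J ^ 2 : ℝ) : ℂ) ^ 2 := by
      rw [hf₁, mul_pow, Complex.I_sq]; push_cast; ring
    rw [e]
    refine h.trans (div_le_div_of_nonneg_right ?_ ht0.le)
    linarith
  have hb₂ : ‖(N : ℂ) ^ 2 + (f₂' + f₂ ^ 2) / t ^ 4‖ ≤ K / t := by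
    have h := norm_sq_add_angular_le (N := N) (by linarith) ht1 hg₂ hh₂
    have e : f₂' + f₂ ^ 2 = Complex.I * (ε * s₁ * M ^ 2 * S : ℝ) -
        ((N * (J + 1) ^ 2 + ε * s₁ * M * C : ℝ) : ℂ) ^ 2 := by
      rw [hf₂, hf₂', mul_pow, neg_sq, Complex.I_sq]; ring
    rw [e]
    refine h.trans (div_le_div_of_nonneg_right ?_ ht0.le)
    linarith
  have hεs : ∀ y : ℝ, |y| ≤ D → |ε * y * S| ≤ B * D := fun y hy => by
    rw [abs_mul, abs_mul, abs_of_nonneg ε0]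
    calc ε * |y| * |S| ≤ 1 * D * 1 := by gcongr; linarith
      _ ≤ _ := by linarith
  have hB0 : 0 ≤ B := by linarith
  obtain ⟨q₁, q₁'⟩ := abs_half_mul_le hB0 hD1 as₂ ad₂ ac₂ aL aL' aL''
  obtain ⟨q₂, q₂'⟩ := abs_half_mul_le hB0 hD1 as₁ ad₁ ac₁ aL aL' aL''
  have np₁ : ‖p₁‖ ≤ K := by
    rw [hp₁, Complex.norm_real, Real.norm_eq_abs, neg_mul, abs_neg]; linarith
  have np₁' : ‖p₁'‖ ≤ K := by
    rw [hp₁', Complex.norm_real, Real.norm_eq_abs, neg_mul, abs_neg]; linarith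
  have np₂ : ‖p₂‖ ≤ K := by
    rw [hp₂]; exact (norm_real_sub_I_mul_le q₂ (hεs d₁ ad₁)).trans (by linarith)
  have np₂' : ‖p₂'‖ ≤ K := by
    rw [hp₂']; exact (norm_real_sub_I_mul_le q₂' (hεs c₁ ac₁)).trans (by linarith)
  have nr : ∀ {y Y : ℝ}, |y| ≤ Y → ‖(y : ℂ)‖ ≤ Y := fun h => by rwa [Complex.norm_real]
  have nA : ‖(A : ℂ)‖ ≤ K := nr (by rw [abs_of_nonneg (by linarith)]; linarith)
  have w₁ := norm_waveCoeff_le ht1 hK1 nA (nr as₁) (nr (ad₁.trans (by linarith)))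
    (nr (ac₁.trans (by linarith))) np₁ np₁' hb₁
  have w₂ := norm_waveCoeff_le ht1 hK1 nA (nr as₂) (nr (ad₂.trans (by linarith)))
    (nr (ac₂.trans (by linarith))) np₂ np₂' hb₂
  have hnw : ‖weight A t‖ = t * Real.exp (-A * t ^ 2) := by rw [norm_weight _ ht0.le]; simp
  obtain ⟨w, hw⟩ : ∃ w, w = weight A t := ⟨_, rfl⟩
  have ne₁ : ‖Complex.exp Ψ₁‖ = Real.exp (-(1 / 2) * (s₂ * L)) := by
    rw [hΨ₁, norm_exp_add_I_mul]
  have ne₂ : ‖Complex.exp Ψ₂‖ = Real.exp (1 / 2 * (s₁ * L)) := by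
    rw [hΨ₂, norm_exp_sub_I_mul]
  have hsL : ∀ y : ℝ, |y| ≤ 1 → |y * L| ≤ 32 * B := fun y hy => by
    rw [abs_mul]
    calc |y| * |L| ≤ 1 * (32 * B) := by gcongr
      _ = _ := one_mul _
  have le₁ : ‖Complex.exp Ψ₁‖ ≤ Q := by
    rw [ne₁]
    exact Real.exp_le_exp.2 (by linarith [(abs_le.1 (hsL s₂ as₂)).1])
  have le₂ : ‖Complex.exp Ψ₂‖ ≤ Q := by
    rw [ne₂]
    exact Real.exp_le_exp.2 (by linarith [(abs_le.1 (hsL s₁ as₁)).2])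
  have hlog2 : ∀ {y z : ℝ}, y + Real.log 2 ≤ z → 2 * Real.exp y ≤ Real.exp z := fun {y z} h => by
    calc 2 * Real.exp y = Real.exp (y + Real.log 2) := by
          rw [Real.exp_add, Real.exp_log (by norm_num), mul_comm]
      _ ≤ _ := Real.exp_le_exp.2 h
  have hlogpos : 0 < Real.log 2 := Real.log_pos (by norm_num)
  -- the three zones
  have hzone : (((s₁ : ℂ) = 1 ∧ 2 * ‖Complex.exp Ψ₂‖ ≤ ‖Complex.exp Ψ₁‖) ∨
      ((s₂ : ℂ) = 1 ∧ 2 * ‖Complex.exp Ψ₁‖ ≤ ‖Complex.exp Ψ₂‖)) ∨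
      (J + 1 / 3 < t ∧ t < J + 2 / 3) := by
    rcases le_or_gt t (J + 1 / 3) with h | h
    · left; left
      have e1 : s₁ = 1 := by rw [hs₁]; exact cutoff_eq_one (by linarith)
      have e2 : L ≤ -(2 * Real.log 2) := hL ▸ blockLog_le_neg hA hAN hj32 hx1 h
      refine ⟨by rw [e1]; simp, ?_⟩
      rw [ne₁, ne₂, e1]
      refine hlog2 ?_
      have : s₂ * L ≤ 0 := mul_nonpos_of_nonneg_of_nonpos s₂0 (by linarith only [e2, hlogpos])
      linarith only [this, e2]
    · rcases le_or_gt (J + 2 / 3) t with h' | h'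
      · left; right
        have e1 : s₂ = 1 := by rw [hs₂]; exact cutoff_eq_one (by linarith)
        have e2 : 2 * Real.log 2 ≤ L := hL ▸ le_blockLog hA hAN hj32 h' hx2
        refine ⟨by rw [e1]; simp, ?_⟩
        rw [ne₁, ne₂, e1]
        refine hlog2 ?_
        have : 0 ≤ s₁ * L := mul_nonneg s₁0 (by linarith only [e2, hlogpos])
        linarith only [this, e2]
      · right; exact ⟨h, h'⟩
  have hmid : J + 1 / 3 < t → t < J + 2 / 3 → s₁ = 1 ∧ s₂ = 1 := fun h h' =>
    ⟨by rw [hs₁]; exact cutoff_eq_one (by linarith),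
      by rw [hs₂]; exact cutoff_eq_one (by linarith)⟩
  rw [← hw] at k1 k2 k3 k4 hnw
  refine ⟨?_, ?_, ?_⟩
  · rw [k1, k4, norm_mul, norm_mul, mul_left_comm]
    refine mul_le_mul_of_nonneg_left ?_ (norm_nonneg w)
    rcases hzone with h | ⟨h, h'⟩
    · have dom := (norm_waves_le_of_dominated (nr as₁) (nr as₂) h).1
      refine (norm_add_le _ _).trans ?_
      rw [norm_mul, norm_mul]
      calc _ ≤ ‖Complex.exp Ψ₁‖ * (8 * K ^ 2 / t) + ‖Complex.exp Ψ₂‖ * (8 * K ^ 2 / t) := by gcongr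
        _ = 8 * K ^ 2 / t * (‖Complex.exp Ψ₁‖ + ‖Complex.exp Ψ₂‖) := by ring
        _ ≤ 8 * K ^ 2 / t * (3 * ‖(s₁ : ℂ) * Complex.exp Ψ₁ + s₂ * Complex.exp Ψ₂‖) := by gcongr
        _ = 24 * K ^ 2 / t * ‖(s₁ : ℂ) * Complex.exp Ψ₁ + s₂ * Complex.exp Ψ₂‖ := by ring
        _ ≤ _ := by
          gcongr
          have : 0 ≤ 1700 * B * Q + 6 + 2 * Q := by positivity
          linarith
    · obtain ⟨e1, e2⟩ := hmid h h'
      have z₁ : d₁ = 0 := by rw [hd₁]; exact deriv_cutoff_eq_zero (by linarith)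
      have z₂ : c₁ = 0 := by rw [hc₁]; exact deriv_deriv_cutoff_eq_zero (by linarith)
      have z₃ : d₂ = 0 := by rw [hd₂, deriv_cutoff_eq_zero (by linarith), neg_zero]
      have z₄ : c₂ = 0 := by rw [hc₂]; exact deriv_deriv_cutoff_eq_zero (by linarith)
      rw [e1, z₁, z₂] at w₁ ⊢
      rw [e2, z₃, z₄] at w₂ ⊢
      simp only [Complex.ofReal_one, Complex.ofReal_zero] at w₁ w₂ ⊢
      rw [e1, one_mul, mul_one] at hΨ₂
      rw [e2, one_mul] at hΨ₁
      rw [e1, mul_one] at hf₂ hf₂'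
      rw [e2, z₃, zero_mul, zero_add, one_mul] at hp₁
      rw [e1, z₁, zero_mul, zero_add, one_mul, mul_zero, zero_mul, Complex.ofReal_zero, mul_zero,
        sub_zero] at hp₂
      rw [e2, z₃, z₄, zero_mul, mul_zero, zero_mul, zero_add, zero_add, one_mul] at hp₁'
      rw [e1, z₁, z₂, zero_mul, mul_zero, zero_mul, zero_add, zero_add, one_mul, mul_zero, zero_mul,
        Complex.ofReal_zero, mul_zero, sub_zero] at hp₂'
      set W₁ := waveCoeff A t 1 0 0 p₁ p₁'
        (N ^ 2 + f₁ ^ 2 / t ^ 4) with hW₁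
      set W₂ := waveCoeff A t 1 0 0 p₂ p₂'
        (N ^ 2 + (f₂' + f₂ ^ 2) / t ^ 4) with hW₂
      have hdiff : W₂ - W₁ = (Complex.I * (ε * M * M * Real.sin (M * ϑ) : ℝ) +
          (-Complex.I * (N * (J + 1) ^ 2 + ε * M * Real.cos (M * ϑ) : ℝ)) ^ 2 +
          ((N * (J + 1) ^ 2 - ε * M) ^ 2 : ℝ)) / t ^ 4 := by
        rw [hW₁, hW₂, hp₁, hp₂, hp₁', hp₂']
        exact waveCoeff_sub_waveCoeff hA ht0 hj32 hL' hL'' hMJ hf₁ (by rw [hf₂, hC])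
          (by rw [hf₂', hS, pow_two, mul_assoc ε M M])
      have hcos := abs_cos_le_norm_exp_add_exp (δ := L) (τ := M * ϑ) (x := N * J ^ 2 * ϑ)
        (y := N * (J + 1) ^ 2 * ϑ + ε * S) ε0 ε1 (by rw [hS, hMJ]; ring)
      have hr₁ : Ψ₁ = -((L / 2 : ℝ) : ℂ) + Complex.I * ((N * J ^ 2 * ϑ : ℝ) : ℂ) := by
        rw [hΨ₁]; push_cast; ring
      have hr₂ : Ψ₂ = ((L / 2 : ℝ) : ℂ) -
          Complex.I * ((N * (J + 1) ^ 2 * ϑ + ε * S : ℝ) : ℂ) := by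
        rw [hΨ₂]; push_cast; ring
      rw [← hr₁, ← hr₂] at hcos
      have hang := norm_angular_sub_le (τ := M * ϑ) (by linarith : (0 : ℝ) ≤ N) ht1
        (by positivity : 0 ≤ ε * M) hεMt hM0 hεMM (by positivity) hn'
      have hd : ‖W₂ - W₁‖ ≤ 1700 * B / t * ‖Complex.exp Ψ₁ + Complex.exp Ψ₂‖ := by
        rw [hdiff, norm_div, norm_pow, Complex.norm_real, Real.norm_of_nonneg ht0.le,
          div_le_iff₀ (by positivity)]
        refine hang.trans ?_
        calc _ ≤ 1700 * (N : ℝ) ^ 2 * t ^ 3 * ‖Complex.exp Ψ₁ + Complex.exp Ψ₂‖ := by gcongr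
          _ = _ := by rw [← hB]; field_simp
      -- The common coefficient multiplies the block itself, and the mismatch `W₂ - W₁` vanishes to
      -- first order where the block can vanish.
      have e : Complex.exp Ψ₁ * W₁ + Complex.exp Ψ₂ * W₂ =
          W₁ * (Complex.exp Ψ₁ + Complex.exp Ψ₂) + (W₂ - W₁) * Complex.exp Ψ₂ := by ring
      rw [e, one_mul, one_mul]
      refine (norm_add_le _ _).trans ?_
      rw [norm_mul, norm_mul]
      calc _ ≤ 8 * K ^ 2 / t * ‖Complex.exp Ψ₁ + Complex.exp Ψ₂‖ +
            1700 * B / t * ‖Complex.exp Ψ₁ + Complex.exp Ψ₂‖ * Q := by gcongr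
        _ = (8 * K ^ 2 + 1700 * B * Q) / t * ‖Complex.exp Ψ₁ + Complex.exp Ψ₂‖ := by ring
        _ ≤ _ := by
          refine mul_le_mul_of_nonneg_right (div_le_div_of_nonneg_right ?_ ht0.le) (norm_nonneg _)
          linarith only [sq_nonneg K, hQ1]
  · have hG : ‖w‖ * (‖Complex.exp Ψ₁‖ + ‖Complex.exp Ψ₂‖) ≤ 6 * ‖fderiv ℝ (block A N j σ) x‖ := by
      have dom : 2 / 3 * (‖Complex.exp Ψ₁‖ + ‖Complex.exp Ψ₂‖) ≤
          ‖(s₁ : ℂ) * Complex.exp Ψ₁‖ + ‖(s₂ : ℂ) * Complex.exp Ψ₂‖ := by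
        rcases hzone with h | ⟨h, h'⟩
        · exact (norm_waves_le_of_dominated (nr as₁) (nr as₂) h).2
        · obtain ⟨e1, e2⟩ := hmid h h'
          rw [e1, e2]
          simp only [Complex.ofReal_one, one_mul]
          linarith [norm_nonneg (Complex.exp Ψ₁), norm_nonneg (Complex.exp Ψ₂)]
      rw [norm_mul] at k2 k3
      refine le_six_mul_of_wave_bounds (norm_nonneg w) hK1 (hjK.trans hx1) hA hAN (nr as₁) (nr as₂)
        dom (X := (d₁ + s₁ * p₁) * Complex.exp Ψ₁ + (d₂ + s₂ * p₂) * Complex.exp Ψ₂)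
        ?_ (f₁ := f₁) (f₂ := f₂) ?_ ?_ k2 k3
      · have hDK : D ≤ K := by linarith only [hK, hDB, hBD, hB1]
        refine (norm_add_le _ _).trans ?_
        rw [norm_mul, norm_mul, mul_add]
        exact add_le_add
          (mul_le_mul_of_nonneg_right (norm_add_mul_le (nr as₁) ((nr ad₁).trans hDK) np₁)
            (norm_nonneg _))
          (mul_le_mul_of_nonneg_right (norm_add_mul_le (nr as₂) ((nr ad₂).trans hDK) np₂)
            (norm_nonneg _))
      · have e : f₁ - Complex.I * (((N : ℝ) : ℂ) * t ^ 2) =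
            Complex.I * ((N * J ^ 2 - N * t ^ 2 : ℝ) : ℂ) := by
          rw [hf₁]; push_cast; ring
        rw [e, norm_mul, Complex.norm_I, one_mul]
        refine (nr hg₁).trans (mul_le_mul_of_nonneg_right ?_ ht0.le)
        linarith
      · have e : f₂ + Complex.I * (((N : ℝ) : ℂ) * t ^ 2) =
            -Complex.I * ((N * (J + 1) ^ 2 + ε * s₁ * M * C - N * t ^ 2 : ℝ) : ℂ) := by
          rw [hf₂]; push_cast; ring
        rw [e, norm_mul, norm_neg, Complex.norm_I, one_mul]
        refine (nr hg₂).trans (mul_le_mul_of_nonneg_right ?_ ht0.le)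
        linarith
    have hR : ‖(s₁ : ℂ) * Complex.exp Ψ₁ + s₂ * Complex.exp Ψ₂‖ ≤
        ‖Complex.exp Ψ₁‖ + ‖Complex.exp Ψ₂‖ := by
      refine (norm_add_le _ _).trans ?_
      rw [norm_mul, norm_mul]
      exact add_le_add (mul_le_of_le_one_left (norm_nonneg _) (nr as₁))
        (mul_le_of_le_one_left (norm_nonneg _) (nr as₂))
    rw [k4, norm_mul]
    refine (mul_le_mul_of_nonneg_left hR (norm_nonneg w)).trans (hG.trans ?_)
    refine mul_le_mul_of_nonneg_right ?_ (norm_nonneg _)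
    have : 0 ≤ 24 * K ^ 2 + 1700 * B * Q + 2 * Q := by positivity
    linarith
  · rw [k4, norm_mul, hnw, mul_comm]
    refine mul_le_mul_of_nonneg_right ?_ (by positivity)
    refine (norm_add_le _ _).trans ?_
    rw [norm_mul, norm_mul]
    have := mul_le_mul (nr as₁) le₁ (norm_nonneg _) zero_le_one
    have := mul_le_mul (nr as₂) le₂ (norm_nonneg _) zero_le_one
    have : 0 ≤ 24 * K ^ 2 + 1700 * B * Q + 6 := by positivity
    linarith

/-! ### Gluing the blocks, and the case `l ≥ 0` -/

lemma conj_unitPhase (σ : ℝ) (x : Plane) :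
    starRingEnd ℂ (unitPhase σ x) = unitPhase (-σ) x := by
  simp [unitPhase]

/-- The exponent of each wave carries the cutoff of the other wave. Where the second wave is off,
the first has lost its correction and is a pure wave, which the neighbouring block can match
exactly. -/
lemma block_eq_of_le (A : ℝ) (N j : ℕ) (σ : ℝ) {x : Plane} (hx : √‖x‖ ≤ j + 1 / 6) :
    block A N j σ x = weight A √‖x‖ * unitPhase σ x ^ (N * j ^ 2) := by
  rw [block, twoWave, cutoff_eq_one (by linarith : √‖x‖ - j ≤ 2 / 3),
    cutoff_eq_zero (by linarith : 5 / 6 ≤ (j : ℝ) + 1 - √‖x‖)]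
  simp

lemma block_eq_of_ge (A : ℝ) (N j : ℕ) (σ : ℝ) {x : Plane} (hx : j + 5 / 6 ≤ √‖x‖) :
    block A N j σ x = weight A √‖x‖ * unitPhase (-σ) x ^ (N * (j + 1) ^ 2) := by
  rw [block, twoWave, cutoff_eq_zero (by linarith : 5 / 6 ≤ √‖x‖ - j),
    cutoff_eq_one (by linarith : (j : ℝ) + 1 - √‖x‖ ≤ 2 / 3), conj_unitPhase]
  simp

/-- The orientation of the block with the number `j`. -/
noncomputable def orientation (j₀ j : ℕ) : ℝ := (-1) ^ (j + j₀)

lemma orientation_eq (j₀ j : ℕ) : orientation j₀ j = 1 ∨ orientation j₀ j = -1 :=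
  neg_one_pow_eq_or ℝ _

lemma orientation_self (j₀ : ℕ) : orientation j₀ j₀ = 1 :=
  Even.neg_one_pow ⟨j₀, rfl⟩

lemma orientation_succ (j₀ j : ℕ) : orientation j₀ (j + 1) = -orientation j₀ j := by
  unfold orientation
  rw [show j + 1 + j₀ = j + j₀ + 1 by ring, pow_succ]; ring

open Classical in
/-- The core wave followed by the blocks with the numbers `j ≥ j₀`. -/
noncomputable def gluedWave (A : ℝ) (N j₀ : ℕ) (x : Plane) : ℂ :=
  if √‖x‖ < j₀ then coreWave A (N * j₀ ^ 2) x
  else block A N ⌊√‖x‖⌋₊ (orientation j₀ ⌊√‖x‖⌋₊) x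

/-- The formula of block `j` reaches down to `j - 1/6`, into the end of its predecessor, where both
are the same pure wave; the alternating orientation makes the directions of rotation agree. Each
point outside the core thus has a neighbourhood with a single formula. -/
lemma gluedWave_eq_block (A : ℝ) (N : ℕ) {j₀ j : ℕ} (h0 : 2 ≤ j₀) (hj : j₀ ≤ j) {x : Plane}
    (h1 : j - 1 / 6 < √‖x‖) (h2 : √‖x‖ < j + 1) :
    gluedWave A N j₀ x = block A N j (orientation j₀ j) x := by
  have hj' : (j₀ : ℝ) ≤ j := by exact_mod_cast hj
  have h0' : (2 : ℝ) ≤ j₀ := by exact_mod_cast h0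
  rcases le_or_gt (j : ℝ) √‖x‖ with h | h
  · have hf : ⌊√‖x‖⌋₊ = j := (Nat.floor_eq_iff (Real.sqrt_nonneg _)).2 ⟨h, h2⟩
    rw [gluedWave, if_neg (by linarith), hf]
  · rcases hj.eq_or_lt with rfl | hlt
    · have hx : 1 ≤ ‖x‖ := by
        have : 1 ≤ √‖x‖ := by linarith
        exact Real.one_le_sqrt.1 this
      rw [gluedWave, if_pos h, block_eq_of_le A N _ _ (by linarith), orientation_self,
        coreWave_eq_weight _ _ hx]
    · obtain ⟨k, rfl⟩ : ∃ k, j = k + 1 := ⟨j - 1, by omega⟩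
      have hk : (j₀ : ℝ) ≤ k := by exact_mod_cast (by omega : j₀ ≤ k)
      push_cast at h h1 h2
      have hf : ⌊√‖x‖⌋₊ = k := (Nat.floor_eq_iff (Real.sqrt_nonneg _)).2
        ⟨by linarith, by linarith⟩
      rw [gluedWave, if_neg (by linarith), hf, block_eq_of_ge A N k _ (by linarith),
        block_eq_of_le A N (k + 1) _ (by push_cast; linarith), orientation_succ]

lemma gluedWave_eventuallyEq_block (A : ℝ) (N : ℕ) {j₀ : ℕ} (h0 : 2 ≤ j₀) {x : Plane}
    (hx : j₀ ≤ √‖x‖) : ∃ j ≥ j₀, (j : ℝ) ≤ √‖x‖ ∧ √‖x‖ ≤ j + 1 ∧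
      gluedWave A N j₀ =ᶠ[𝓝 x] block A N j (orientation j₀ j) := by
  have h1 := Nat.floor_le (Real.sqrt_nonneg ‖x‖)
  have h2 := Nat.lt_floor_add_one √‖x‖
  have hc : Continuous fun y : Plane => √‖y‖ := continuous_norm.sqrt
  refine ⟨⌊√‖x‖⌋₊, Nat.le_floor hx, h1, h2.le, ?_⟩
  filter_upwards [hc.continuousAt.eventually_const_lt (by linarith : ⌊√‖x‖⌋₊ - 1 / 6 < √‖x‖),
    hc.continuousAt.eventually_lt_const h2] with y hy1 hy2
  exact gluedWave_eq_block A N h0 (Nat.le_floor hx) hy1 hy2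

lemma gluedWave_eventuallyEq_coreWave (A : ℝ) (N : ℕ) {j₀ : ℕ} {x : Plane}
    (hx : √‖x‖ < j₀) : gluedWave A N j₀ =ᶠ[𝓝 x] coreWave A (N * j₀ ^ 2) := by
  have hc : Continuous fun y : Plane => √‖y‖ := continuous_norm.sqrt
  filter_upwards [hc.continuousAt.eventually_lt_const hx] with y hy
  rw [gluedWave, if_pos hy]

lemma contDiff_gluedWave (A : ℝ) (N : ℕ) {j₀ : ℕ} (h0 : 2 ≤ j₀) :
    ContDiff ℝ 2 (gluedWave A N j₀) := by
  refine contDiff_iff_contDiffAt.2 fun x => ?_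
  rcases lt_or_ge √‖x‖ (j₀ : ℝ) with hx | hx
  · exact (contDiff_coreWave _ _).contDiffAt.congr_of_eventuallyEq
      (gluedWave_eventuallyEq_coreWave A N hx)
  · obtain ⟨j, -, -, -, hj⟩ := gluedWave_eventuallyEq_block A N h0 hx
    have h0' : (2 : ℝ) ≤ j₀ := by exact_mod_cast h0
    have hx0 : x ≠ 0 := by
      rintro rfl
      simp at hx
      omega
    exact (contDiffAt_block A N j _ hx0).congr_of_eventuallyEq hj

/-- A decay rate `A > 0` is compatible with `l ≥ 0` because the rotation supplies `N² = A² + l`. The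
core carries the frequency `N j₀²` of the first block. -/
lemma hasDecayingSolution_of_nonneg {l : ℂ} (him : l.im = 0) (hre : 0 ≤ l.re) :
    HasDecayingSolution l := by
  -- From `N ≥ l + 1` follows `N² - l ≥ 1`, hence `A ≥ 1`; and `l ≥ 0` gives `A ≤ N`.
  obtain ⟨N, hN⟩ : ∃ N : ℕ, l.re + 1 ≤ N := exists_nat_ge _
  have hN1 : (1 : ℝ) ≤ N := by linarith
  have hsq : (0 : ℝ) ≤ N ^ 2 - l.re := by nlinarith
  set A := √((N : ℝ) ^ 2 - l.re) with hAdef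
  have hA2 : A ^ 2 = N ^ 2 - l.re := Real.sq_sqrt hsq
  have hA : 1 ≤ A := Real.one_le_sqrt.2 (by nlinarith)
  have hAN : A ≤ N := Real.sqrt_le_iff.2 ⟨by linarith, by linarith⟩
  have hl : (A : ℂ) ^ 2 + l = N ^ 2 := by
    have : l = (l.re : ℂ) := Complex.ext (by simp) (by simp [him])
    rw [this, ← Complex.ofReal_pow, hA2]
    push_cast; ring
  obtain ⟨j₀, C, hj₀, hC, hest⟩ := block_estimates hA hAN hl
  have hj₀' : (32 : ℝ) ≤ j₀ := by exact_mod_cast hj₀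
  have h02 : 2 ≤ j₀ := by omega
  set n := N * j₀ ^ 2 with hn
  have hn1 : 1 ≤ n := by
    have : 1 ≤ N := by exact_mod_cast hN1
    exact Nat.mul_pos this (by positivity)
  set ρ : ℝ := (j₀ : ℝ) ^ 2 with hρ
  have hρ1 : 1 ≤ ρ := one_le_pow₀ (by linarith)
  obtain ⟨C₁, hC₁, hcore⟩ := exists_bound_coreWave A l n ρ
  have hlt : ∀ x : Plane, √‖x‖ < j₀ → ‖x‖ ≤ ρ := fun x hx =>
    ((Real.sqrt_lt' (by linarith)).1 hx).le
  have hge : ∀ x : Plane, ρ ≤ ‖x‖ → j₀ ≤ √‖x‖ := fun x hx =>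
    (Real.le_sqrt (by linarith) (norm_nonneg x)).2 hx
  have hblock : ∀ x : Plane, (j₀ : ℝ) ≤ √‖x‖ →
      ‖(Δ (gluedWave A N j₀)) x + l * gluedWave A N j₀ x‖ ≤
        C / √‖x‖ * ‖gluedWave A N j₀ x‖ ∧
      ‖gluedWave A N j₀ x‖ ≤ C * ‖fderiv ℝ (gluedWave A N j₀) x‖ ∧
      ‖gluedWave A N j₀ x‖ ≤ C * (√‖x‖ * Real.exp (-A * √‖x‖ ^ 2)) := fun x hx => by
    obtain ⟨j, hj, h1, h2, hev⟩ := gluedWave_eventuallyEq_block A N h02 hx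
    rw [(InnerProductSpace.laplacian_congr_nhds hev).eq_of_nhds, hev.fderiv_eq, hev.eq_of_nhds]
    exact hest j hj _ (orientation_eq j₀ j) x h1 h2
  have hA0 : 0 < A := by linarith
  refine hasDecayingSolution_of_bounds (contDiff_gluedWave A N h02) (fun h => ?_) (ρ := ρ)
    (C := C + C₁ + ρ + C * (2 / A)) (c := A / 2) hρ1 (by positivity) (by positivity)
    (fun x hx => ?_) (fun x hx => ?_) (fun x => ?_) (fun x hx => ?_)
  · have hr : √‖radialVec 0‖ < j₀ := by rw [norm_radialVec, Real.sqrt_one]; linarith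
    have h1 := congrFun h (radialVec 0)
    rw [(gluedWave_eventuallyEq_coreWave A N hr).eq_of_nhds] at h1
    exact coreWave_ne_zero A n
      (norm_pos_iff.1 (by rw [norm_radialVec]; exact one_pos)) h1
  · rcases lt_or_ge √‖x‖ (j₀ : ℝ) with hx' | hx'
    · have hev := gluedWave_eventuallyEq_coreWave A N hx'
      rw [(InnerProductSpace.laplacian_congr_nhds hev).eq_of_nhds, hev.eq_of_nhds]
      refine (hcore x hx).trans (mul_le_mul_of_nonneg_right ?_ (norm_nonneg _))
      have : 0 ≤ C + ρ + C * (2 / A) := by positivity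
      linarith
    · refine (hblock x hx').1.trans (mul_le_mul_of_nonneg_right ?_ (norm_nonneg _))
      have h1 : C / √‖x‖ ≤ C := div_le_self hC.le (by linarith)
      have : 0 ≤ C₁ + ρ + C * (2 / A) := by positivity
      linarith
  · refine (hblock x (hge x hx)).1.trans (mul_le_mul_of_nonneg_right
      (div_le_div_of_nonneg_right ?_ (Real.sqrt_nonneg _)) (norm_nonneg _))
    have : 0 ≤ C₁ + ρ + C * (2 / A) := by positivity
    linarith
  · rcases lt_or_ge √‖x‖ (j₀ : ℝ) with hx' | hx'
    · have hev := gluedWave_eventuallyEq_coreWave A N hx'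
      rw [hev.fderiv_eq, hev.eq_of_nhds]
      refine (norm_le_norm_fderiv_coreWave A hn1 x).trans
        (mul_le_mul_of_nonneg_right ((hlt x hx').trans ?_) (norm_nonneg _))
      have : 0 ≤ C + C₁ + C * (2 / A) := by positivity
      linarith
    · refine (hblock x hx').2.1.trans (mul_le_mul_of_nonneg_right ?_ (norm_nonneg _))
      have : 0 ≤ C₁ + ρ + C * (2 / A) := by positivity
      linarith
  · have h1 := hge x hx
    refine (hblock x h1).2.2.trans ?_
    refine (mul_le_mul_of_nonneg_left (mul_exp_neg_sq_le hA0 (by linarith)) hC.le).trans ?_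
    rw [Real.sq_sqrt (norm_nonneg x), ← mul_assoc]
    refine mul_le_mul_of_nonneg_right ?_ (Real.exp_pos _).le
    have : 0 ≤ C + C₁ + ρ := by positivity
    linarith

lemma hasDecayingSolution (l : ℂ) : HasDecayingSolution l := by
  by_cases h : l.im = 0 ∧ 0 ≤ l.re
  · exact hasDecayingSolution_of_nonneg h.1 h.2
  · obtain ⟨A, hA, hre⟩ := exists_sqrt_neg h
    exact hasDecayingSolution_of_sq hA hre

lemma bracket_rpow_le_one (x : Plane) : bracket x ^ (-(1 / 2) : ℝ) ≤ 1 :=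
  Real.rpow_le_one_of_one_le_of_nonpos (one_le_bracket x) (by norm_num)

end BorderlineDecay

theorem theorem1p4 (l : ℂ) (N P : ℝ) (hN : 0 ≤ N) (hP : 0 ≤ P)
    (hc : BorderlineDecay.betaC N P = 1) (h0 : BorderlineDecay.betaZero N P = 1) :
    ((4 - 2 * N) / 3 = 1 →
      ∃ (V : BorderlineDecay.Plane → ℂ) (u : BorderlineDecay.Plane → ℂ),
        Measurable V ∧ BorderlineDecay.IsPotentialEigenfunction l V u ∧
        (∃ C : ℝ, 0 < C ∧ (∀ x, ‖V x‖ ≤ C) ∧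
          ∀ x, 2 ≤ ‖x‖ →
            ‖V x‖ ≤ C * Real.log ‖x‖ * BorderlineDecay.bracket x ^ (-(1 / 2) : ℝ)) ∧
        BorderlineDecay.DecaysExponentially u) ∧
    (2 - 2 * P = 1 →
      ∃ (W : BorderlineDecay.Plane → EuclideanSpace ℂ (Fin 2)) (u : BorderlineDecay.Plane → ℂ),
        Measurable W ∧ BorderlineDecay.IsDriftEigenfunction l W u ∧
        (∃ C : ℝ, 0 < C ∧
          ∀ x, ‖W x‖ ≤ C * BorderlineDecay.bracket x ^ (-(1 / 2) : ℝ)) ∧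
        BorderlineDecay.DecaysExponentially u) ∧
    ((4 - 2 * N) / 3 = 1 → l.im = 0 → 0 < l.re →
      ∃ (V : BorderlineDecay.Plane → ℂ) (u : BorderlineDecay.Plane → ℂ),
        Measurable V ∧ BorderlineDecay.IsPotentialEigenfunction l V u ∧
        (∃ C : ℝ, 0 < C ∧
          ∀ x, ‖V x‖ ≤ C * BorderlineDecay.bracket x ^ (-(1 / 2) : ℝ)) ∧
        BorderlineDecay.DecaysExponentially u) := by
  have hsol := BorderlineDecay.hasDecayingSolution l
  refine ⟨fun _ => ?_, fun _ => hsol.exists_drift, fun _ _ _ => hsol.exists_potential⟩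
  obtain ⟨V, u, hV, hu, ⟨C, hC, hVC⟩, hd⟩ := hsol.exists_potential
  have hlog : 0 < Real.log 2 := Real.log_pos (by norm_num)
  -- The summand `C / log 2` inserts the logarithm, as `log|x| ≥ log 2` for `|x| ≥ 2`; the summand
  -- `C` gives the global bound.
  refine ⟨V, u, hV, hu, ⟨C + C / Real.log 2, by positivity, fun x => ?_, fun x hx => ?_⟩, hd⟩
  · refine (hVC x).trans ?_
    have h1 := mul_le_mul_of_nonneg_left (BorderlineDecay.bracket_rpow_le_one x) hC.le
    have h2 : 0 ≤ C / Real.log 2 := by positivity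
    linarith
  · refine (hVC x).trans (mul_le_mul_of_nonneg_right ?_
      (Real.rpow_nonneg (BorderlineDecay.bracket_pos x).le _))
    have h1 : Real.log 2 ≤ Real.log ‖x‖ := Real.log_le_log (by norm_num) hx
    have h2 : C / Real.log 2 * Real.log 2 = C := div_mul_cancel₀ C hlog.ne'
    have h3 : C / Real.log 2 * Real.log 2 ≤ C / Real.log 2 * Real.log ‖x‖ :=
      mul_le_mul_of_nonneg_left h1 (by positivity)
    have h4 : 0 ≤ C * Real.log ‖x‖ := mul_nonneg hC.le (by linarith)
    linarith
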